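/- Let $1\le k\le N$, let $f_1,\dots,f_N$ be real affine forms on $\mathbb R^k$ whose hyperplanes $H_j=\{f_j=0\}$ are distinct and generic (any $k$ of them meet in exactly one point, no $k+1$ of them have a common point), let $l_j=f_j-f_j(0)$, and let $\alpha_1,\dots,\alpha_N>0$; for $U\subset\{1,\dots,N\}$ put $\alpha_U=\sum_{j\in U}\alpha_j$. Let $f_0$ be a linear form on $\mathbb R^k$ that takes distinct values at the vertices of the arrangement and is nonconstant on the intersection line of any $k-1$ of the hyperplanes. A vertex $X$ is regarded both as a $k$-element subset of $\{1,\dots,N\}$ and as the point $\bigcap_{j\in X}H_j$. Let $\mathcal D^+$ be the set of connected components of $\mathbb R^k\setminus\bigcup_jH_j$ on which $f_0$ is bounded from below. For a vertex $X$ let $\Delta_X$ be the unique component having $X$ in its boundary and on which $f_0>f_0(X)$. For $j\in X$ let $e_{X\setminus\{j\}}$ be the vector with $l_i(e_{X\setminus\{j\}})=0$ for all $i\in X\setminus\{j\}$ and $f_0(e_{X\setminus\{j\}})=1$, and for $\rho\in\mathbb C$, $|\rho|=1$, put $$\mathcal C_X^\rho=\Big\{X+\rho\sum_{j\in X}a_je_{X\setminus\{j\}}\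 :\ a_j>0\Big\}\subset\mathbb C^k,\qquad \mathcal C_X^+=\mathcal C_X^1\subset\mathbb R^k .$$ Fix an orientation of $\mathbb R^k$. For a vertex $X'=\{j_1,\dots,j_k\}$, ordered so that $df_{j_1}\wedge\dots\wedge df_{j_k}$ is positively oriented, let $\omega_{X'}=\frac{df_{j_1}}{f_{j_1}}\wedge\dots\wedge\frac{df_{j_k}}{f_{j_k}}$. For $\Delta\in\mathcal D^+$ and $\lambda>0$ let $I_\Delta(\lambda)$ be the vector, indexed by the vertices $X'$, with components $$I_{\Delta,X'}(\lambda)=\int_\Delta e^{-\lambda f_0}\prod_{j=1}^N|f_j|^{\alpha_j}\,\omega_{X'} .$$ For a vertex $X$ and $\rho\notin\mathbb R$, $|\rho|=1$, $\operatorname{Re}(\rho\lambda)>0$, let $I_X^\rho(\lambda)$ be the vector with components $$I_{X,X'}^\rho(\lambda)=\int_{\mathcal C_X^\rho}e^{-\lambda f_0}\Big(\prod_{j=1}^N|f_j|^{\alpha_j}\Big)\omega_{X'} ,$$ where $f_0,f_1,\dots,f_N$ and $\omega_{X'}$ are extended to $\mathbb C^k$, the cone $\mathcal C_X^\rho$ is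 oriented as the image of $\mathcal C_X^+$ under $x\mapsto X+\rho(x-X)$, and $\prod_j|f_j|^{\alpha_j}$ stands for the analytic continuation of this positive function from $\Delta_X$, along a domain of $\mathbb C^k$ that avoids the complexified hyperplanes and contains all the cones $\mathcal C_X^{\rho'}$, $|\rho'|=1$, with $\operatorname{Im}\rho'$ of the same sign as $\operatorname{Im}\rho$. For domains $\Delta,\Delta'$ let $\mathcal H(\Delta,\Delta')$ be the set of all $j$ such that $H_j$ separates $\Delta$ from $\Delta'$, and put $\psi(\Delta,X)=1$ if $\Delta=\Delta_X$, and $\psi(\Delta,X)=(-1)^{|\mathcal H(\Delta,\Delta_X)|}e^{i\pi\alpha_{\mathcal H(\Delta,\Delta_X)}}$ otherwise. Then for every $\Delta\in\mathcal D^+$ and every $\lambda>0$ all these integrals converge absolutely; for each vertex $X$ the vector $I_X^\rho(\lambda)$ has a value $I_X^+(\lambda)$ that is the same for all $\rho$ with $|\rho|=1$, $\operatorname{Im}\rho<0$, $\operatorname{Re}(\rho\lambda)>0$, and a value $I_X^-(\lambda)$ that is the same for all $\rho$ with $|\rho|=1$, $\operatorname{Im}\rho>0$, $\operatorname{Re}(\rho\lambda)>0$;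 and $$I_\Delta(\lambda)=\sum_{X\in\partial\Delta}\psi(\Delta,X)\,I_X^+(\lambda),\qquad I_\Delta(\lambda)=\sum_{X\in\partial\Delta}\overline{\psi(\Delta,X)}\,I_X^-(\lambda),$$ the sums being over all vertices $X$ in the boundary of $\Delta$. -/

import Mathlib

open Set Filter Topology MeasureTheory

noncomputable section

/-- A generic weighted arrangement of `N` affine hyperplanes `H j = {f j = 0}` in `ℝ^k`, with
positive weights `α j`, together with a linear form `f0` in general position. -/
structure Arrangement (k N : ℕ) where
  /-- the affine forms -/
  f : Fin N → ((Fin k → ℝ) →ᵃ[ℝ] ℝ)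
  /-- the linear form in the exponential -/
  f0 : (Fin k → ℝ) →ₗ[ℝ] ℝ
  /-- the weights -/
  α : Fin N → ℝ
  /-- the dimension is positive, and there are at least `k` hyperplanes -/
  k_pos : 0 < k
  k_le : k ≤ N
  α_pos : ∀ j, 0 < α j
  /-- the hyperplanes are distinct -/
  distinct : Function.Injective fun j => {x | f j x = 0}
  /-- any `k` hyperplanes meet in exactly one point -/
  inter_k : ∀ X : Finset (Fin N), X.card = k → ∃! x, ∀ j ∈ X, f j x = 0
  /-- any `k + 1` hyperplanes have empty intersection -/
  inter_succ : ∀ Y : Finset (Fin N), Y.card = k + 1 → ¬ ∃ x, ∀ j ∈ Y, f j x = 0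
  /-- `f0` takes distinct values on the vertices -/
  f0_vertices : ∀ X Y : Finset (Fin N), X.card = k → Y.card = k → X ≠ Y →
    ∀ x y, (∀ j ∈ X, f j x = 0) → (∀ j ∈ Y, f j y = 0) → f0 x ≠ f0 y
  /-- `f0` is nonconstant on the intersection line of any `k - 1` hyperplanes -/
  f0_edges : ∀ U : Finset (Fin N), U.card + 1 = k →
    ∃ x y, (∀ j ∈ U, f j x = 0) ∧ (∀ j ∈ U, f j y = 0) ∧ f0 x ≠ f0 y

namespace Arrangement

variable {k N : ℕ} (A : Arrangement k N)

/-- Vertices, as subsets of `{1, …, N}` with `k` elements. -/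
abbrev Vertex (_A : Arrangement k N) : Type := {X : Finset (Fin N) // X.card = k}

/-- The point of `ℝ^k` at which the hyperplanes of the vertex `X` meet. -/
def point (X : A.Vertex) : Fin k → ℝ := (A.inter_k X.1 X.2).choose

/-- The linear form `l j = f j - f j 0` directing `f j`. -/
def l (j : Fin N) : (Fin k → ℝ) →ₗ[ℝ] ℝ := (A.f j).linear

lemma f_point (X : A.Vertex) {j : Fin N} (hj : j ∈ X.1) : A.f j (A.point X) = 0 :=
  (A.inter_k X.1 X.2).choose_spec.1 j hj

lemma f_point_ne (X : A.Vertex) {j : Fin N} (hj : j ∉ X.1) : A.f j (A.point X) ≠ 0 := by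
  intro h
  refine A.inter_succ (insert j X.1) (by rw [Finset.card_insert_of_notMem hj, X.2])
    ⟨A.point X, fun i hi => ?_⟩
  rcases Finset.mem_insert.1 hi with rfl | hi
  · exact h
  · exact A.f_point X hi

lemma f_add (j : Fin N) (x v : Fin k → ℝ) : A.f j (x + v) = A.f j x + A.l j v := by
  have := (A.f j).map_vadd x v
  simp only [vadd_eq_add] at this
  rw [add_comm x v, this, add_comm, l]

lemma eq_zero_of_l (X : A.Vertex) (v : Fin k → ℝ) (hv : ∀ j ∈ X.1, A.l j v = 0) : v = 0 := by
  have h := (A.inter_k X.1 X.2).choose_spec.2 (A.point X + v) (fun j hj => by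
    rw [A.f_add, A.f_point X hj, hv j hj, add_zero])
  have h' : A.point X + v = A.point X := h
  simpa using h'

lemma existsUnique_edge (X : A.Vertex) (j : {j // j ∈ X.1}) :
    ∃! e : Fin k → ℝ, (∀ i ∈ X.1.erase j.1, A.l i e = 0) ∧ A.f0 e = 1 := by
  obtain ⟨x, y, hx, hy, hne⟩ := A.f0_edges (X.1.erase j.1)
    (by rw [Finset.card_erase_add_one j.2, X.2])
  have key : ∀ i ∈ X.1.erase j.1, A.l i (x - y) = 0 := by
    intro i hi
    have := A.f_add i y (x - y)
    rw [add_sub_cancel, hx i hi, hy i hi] at this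
    linarith
  have hsub : A.f0 x - A.f0 y ≠ 0 := sub_ne_zero.2 hne
  refine ⟨(A.f0 x - A.f0 y)⁻¹ • (x - y), ⟨fun i hi => by rw [map_smul, key i hi, smul_zero],
    by rw [map_smul, map_sub, smul_eq_mul, inv_mul_cancel₀ hsub]⟩, ?_⟩
  have uniq : ∀ e e' : Fin k → ℝ, ((∀ i ∈ X.1.erase j.1, A.l i e = 0) ∧ A.f0 e = 1) →
      ((∀ i ∈ X.1.erase j.1, A.l i e' = 0) ∧ A.f0 e' = 1) → e' = e := by
    rintro e e' ⟨h1, h2⟩ ⟨h1', h2'⟩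
    have hz : A.l j.1 e • e' - A.l j.1 e' • e = 0 := by
      refine A.eq_zero_of_l X _ fun i hi => ?_
      by_cases hij : i = j.1
      · subst hij; simp [mul_comm]
      · have hi' := Finset.mem_erase.2 ⟨hij, hi⟩
        simp [h1 i hi', h1' i hi']
    have hlj : A.l j.1 e ≠ 0 := by
      intro h0
      have : e = 0 := by
        refine A.eq_zero_of_l X _ fun i hi => ?_
        by_cases hij : i = j.1
        · rw [hij]; exact h0
        · exact h1 i (Finset.mem_erase.2 ⟨hij, hi⟩)
      rw [this, map_zero] at h2
      exact zero_ne_one h2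
    have h0 := congrArg A.f0 hz
    rw [map_sub, map_smul, map_smul, h2, h2', map_zero, smul_eq_mul, smul_eq_mul, mul_one,
      mul_one, sub_eq_zero] at h0
    rw [← h0, ← smul_sub] at hz
    exact sub_eq_zero.1 ((smul_eq_zero.1 hz).resolve_left hlj)
  intro e' he'
  exact uniq _ _ ⟨fun i hi => by rw [map_smul, key i hi, smul_zero],
    by rw [map_smul, map_sub, smul_eq_mul, inv_mul_cancel₀ hsub]⟩ he'

/-- For `j ∈ X`, the vector directing the edge `⋂ i ∈ X \ {j}, H i`, normalized by `f0 = 1`. -/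
def edge (X : A.Vertex) (j : {j // j ∈ X.1}) : Fin k → ℝ := (A.existsUnique_edge X j).choose

lemma l_edge (X : A.Vertex) (j : {j // j ∈ X.1}) {i : Fin N} (hi : i ∈ X.1) (hij : i ≠ j.1) :
    A.l i (A.edge X j) = 0 :=
  (A.existsUnique_edge X j).choose_spec.1.1 i (Finset.mem_erase.2 ⟨hij, hi⟩)

lemma f0_edge (X : A.Vertex) (j : {j // j ∈ X.1}) : A.f0 (A.edge X j) = 1 :=
  (A.existsUnique_edge X j).choose_spec.1.2

lemma l_edge_self (X : A.Vertex) (j : {j // j ∈ X.1}) : A.l j.1 (A.edge X j) ≠ 0 := by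
  intro h0
  have h : A.edge X j = 0 := by
    refine A.eq_zero_of_l X _ fun i hi => ?_
    by_cases hij : i = j.1
    · rw [hij]; exact h0
    · exact A.l_edge X j hi hij
  have h1 := A.f0_edge X j
  rw [h, map_zero] at h1
  exact zero_ne_one h1

/-- The open cone `C_X^+ = {X + ∑ a j • e_{X \ {j}}, a j > 0}`: the cone cut out by the
hyperplanes of `X` on which `f0 > f0(X)`. -/
def cone (X : A.Vertex) : Set (Fin k → ℝ) :=
  {x | ∃ a : {j // j ∈ X.1} → ℝ, (∀ j, 0 < a j) ∧ x = A.point X + ∑ j, a j • A.edge X j}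

/-- The complement of the hyperplanes. -/
def compl : Set (Fin k → ℝ) := {x | ∀ j, A.f j x ≠ 0}

/-- The arrangement domains: connected components of the complement of the hyperplanes. -/
def domains : Set (Set (Fin k → ℝ)) :=
  {Δ | ∃ x ∈ A.compl, Δ = connectedComponentIn A.compl x}

/-- The arrangement domains on which `f0` is bounded from below. -/
def domainsPlus : Set (Set (Fin k → ℝ)) :=
  {Δ | Δ ∈ A.domains ∧ BddBelow (A.f0 '' Δ)}

lemma continuous_f (j : Fin N) : Continuous (A.f j) :=
  (A.f j).continuous_of_finiteDimensional

/-- A domain is determined by the signs of the forms on it. -/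
lemma component_eq {x : Fin k → ℝ} (hx : x ∈ A.compl) :
    connectedComponentIn A.compl x = {y | ∀ j, 0 < A.f j x * A.f j y} := by
  apply Subset.antisymm
  · intro y hy j
    by_contra hneg
    push Not at hneg
    have hpre : IsPreconnected (A.f j '' connectedComponentIn A.compl x) :=
      isPreconnected_connectedComponentIn.image _ (A.continuous_f j).continuousOn
    have hxm : A.f j x ∈ A.f j '' connectedComponentIn A.compl x :=
      mem_image_of_mem _ (mem_connectedComponentIn hx)
    have hym := mem_image_of_mem (A.f j) hy
    have h0 : (0 : ℝ) ∈ A.f j '' connectedComponentIn A.compl x := by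
      rcases le_total (A.f j x) 0 with h | h
      · have hx' : A.f j x < 0 := lt_of_le_of_ne h (hx j)
        exact hpre.ordConnected.out hxm hym ⟨h, by nlinarith⟩
      · have hx' : 0 < A.f j x := lt_of_le_of_ne h (hx j).symm
        exact hpre.ordConnected.out hym hxm ⟨by nlinarith, h⟩
    obtain ⟨z, hz, hz0⟩ := h0
    exact connectedComponentIn_subset _ _ hz j hz0
  · have hconv : Convex ℝ {y | ∀ j, 0 < A.f j x * A.f j y} := by
      rw [Set.ofPred_forall]
      refine convex_iInter fun j => ?_
      intro y hy z hz a b ha hb hab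
      simp only [Set.mem_ofPred_eq] at hy hz ⊢
      rw [Convex.combo_affine_apply hab, smul_eq_mul, smul_eq_mul]
      rcases ha.eq_or_lt with h | h
      · have : b = 1 := by linarith
        subst this; rw [← h]; linarith
      · nlinarith [mul_pos h hy, mul_nonneg hb hz.le]
    refine hconv.isPreconnected.subset_connectedComponentIn
      (fun j => mul_self_pos.2 (hx j)) fun y hy j h0 => ?_
    have := hy j
    rw [h0, mul_zero] at this
    exact lt_irrefl _ this

lemma exists_small (X : A.Vertex) (w : Fin k → ℝ) (r : ℝ) (hr : 0 < r) :
    ∃ ε : ℝ, 0 < ε ∧ ε < r ∧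
      ∀ j ∉ X.1, 0 < A.f j (A.point X) * A.f j (A.point X + ε • w) := by
  have h : ∀ᶠ ε : ℝ in 𝓝[>] 0,
      ∀ j ∉ X.1, 0 < A.f j (A.point X) * A.f j (A.point X + ε • w) := by
    rw [Filter.eventually_all]
    intro j
    by_cases hj : j ∈ X.1
    · exact Eventually.of_forall fun _ h => absurd hj h
    · have hc : Continuous fun ε : ℝ => A.f j (A.point X) * A.f j (A.point X + ε • w) := by
        have := A.continuous_f j
        fun_prop
      have h0 : 0 < A.f j (A.point X) * A.f j (A.point X + (0 : ℝ) • w) := by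
        rw [zero_smul, add_zero]; exact mul_self_pos.2 (A.f_point_ne X hj)
      filter_upwards [nhdsWithin_le_nhds (hc.continuousAt.eventually (lt_mem_nhds h0))] with ε hε
      exact fun _ => hε
  obtain ⟨ε, h1, h2, h3⟩ := ((h.and (Ioo_mem_nhdsGT hr)).exists)
  exact ⟨ε, h2, h3, h1⟩

lemma eq_sum_edge (X : A.Vertex) (v : Fin k → ℝ) :
    v = ∑ j : {j // j ∈ X.1}, (A.l j.1 v / A.l j.1 (A.edge X j)) • A.edge X j := by
  rw [← sub_eq_zero]
  refine A.eq_zero_of_l X _ fun i hi => ?_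
  rw [map_sub, map_sum, Finset.sum_eq_single (⟨i, hi⟩ : {j // j ∈ X.1})]
  · rw [map_smul, smul_eq_mul, div_mul_cancel₀ _ (A.l_edge_self X ⟨i, hi⟩), sub_self]
  · intro j _ hj
    rw [map_smul, A.l_edge X j hi (fun h => hj (Subtype.ext h.symm)), smul_zero]
  · simp

lemma f0_eq_sum (X : A.Vertex) (v : Fin k → ℝ) :
    A.f0 v = ∑ j : {j // j ∈ X.1}, A.l j.1 v / A.l j.1 (A.edge X j) := by
  conv_lhs => rw [A.eq_sum_edge X v]
  rw [map_sum]
  exact Finset.sum_congr rfl fun j _ => by rw [map_smul, A.f0_edge, smul_eq_mul, mul_one]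

lemma l_sum_edge (X : A.Vertex) (a : {j // j ∈ X.1} → ℝ) (i : {j // j ∈ X.1}) :
    A.l i.1 (∑ j, a j • A.edge X j) = a i * A.l i.1 (A.edge X i) := by
  rw [map_sum, Finset.sum_eq_single i]
  · rw [map_smul, smul_eq_mul]
  · intro j _ hj
    rw [map_smul, A.l_edge X j i.2 (fun h => hj (Subtype.ext h.symm)), smul_zero]
  · simp

/-- The domains having the vertex `X` in their boundary and on which `f0 - f0(X) > 0`. -/
def IsDomainAt (X : A.Vertex) (Δ : Set (Fin k → ℝ)) : Prop :=
  Δ ∈ A.domains ∧ A.point X ∈ frontier Δ ∧ ∀ x ∈ Δ, A.f0 (A.point X) < A.f0 x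

/-- The sign description of such a domain. -/
lemma isDomainAt_signs (X : A.Vertex) {Δ : Set (Fin k → ℝ)} (h : A.IsDomainAt X Δ) :
    Δ = {y | (∀ j : {j // j ∈ X.1}, 0 < A.l j.1 (A.edge X j) * A.f j.1 y) ∧
      ∀ j ∉ X.1, 0 < A.f j (A.point X) * A.f j y} := by
  obtain ⟨⟨x, hx, rfl⟩, hfr, hpos⟩ := h
  rw [A.component_eq hx] at hfr hpos ⊢
  have hout : ∀ j ∉ X.1, 0 < A.f j (A.point X) * A.f j x := by
    intro j hj
    have hcl : A.point X ∈ {y | 0 ≤ A.f j x * A.f j y} := by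
      have hclosed : IsClosed {y | 0 ≤ A.f j x * A.f j y} :=
        isClosed_le continuous_const (continuous_const.mul (A.continuous_f j))
      exact hclosed.closure_subset_iff.2 (fun y hy => (hy j).le) (frontier_subset_closure hfr)
    rw [mul_comm]
    exact lt_of_le_of_ne hcl (mul_ne_zero (hx j) (A.f_point_ne X hj)).symm
  have hin : ∀ j : {j // j ∈ X.1}, 0 < A.l j.1 (A.edge X j) * A.f j.1 x := by
    intro j
    by_contra hneg
    push Not at hneg
    have hlt : A.l j.1 (A.edge X j) * A.f j.1 x < 0 :=
      lt_of_le_of_ne hneg (mul_ne_zero (A.l_edge_self X j) (hx j.1))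
    set v := x - A.point X with hv
    set M := |A.f0 v| + 1 with hM
    have hMpos : 0 < M := by positivity
    obtain ⟨ε, hε, -, hsm⟩ := A.exists_small X (v - M • A.edge X j) 1 one_pos
    have hlv : ∀ i ∈ X.1, A.l i v = A.f i x := by
      intro i hi
      have := A.f_add i (A.point X) v
      rw [hv, add_sub_cancel, A.f_point X hi, zero_add] at this
      rw [hv, ← this]
    have hmem : A.point X + ε • (v - M • A.edge X j) ∈ {y | ∀ j, 0 < A.f j x * A.f j y} := by
      intro i
      by_cases hi : i ∈ X.1
      · rw [A.f_add, A.f_point X hi, zero_add, map_smul, map_sub, map_smul, hlv i hi,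
          smul_eq_mul, smul_eq_mul]
        have hxx : 0 < A.f i x * A.f i x := mul_self_pos.2 (hx i)
        by_cases hij : i = j.1
        · subst hij
          have h1 : 0 < A.f j.1 x * A.f j.1 x - M * (A.l j.1 (A.edge X j) * A.f j.1 x) := by
            nlinarith
          nlinarith [mul_pos hε h1]
        · rw [A.l_edge X j hi hij]
          nlinarith [mul_pos hε hxx]
      · have h1 := hsm i hi
        have h2 := hout i hi
        have h3 : 0 < A.f i (A.point X) * A.f i (A.point X) := mul_self_pos.2 (A.f_point_ne X hi)
        have h4 := mul_pos h2 h1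
        by_contra hcon
        push Not at hcon
        nlinarith [mul_nonneg h3.le (neg_nonneg.2 hcon)]
    have h1 := hpos _ hmem
    rw [map_add, map_smul, map_sub, map_smul, A.f0_edge, smul_eq_mul, smul_eq_mul] at h1
    have h2 : A.f0 v - M * 1 < 0 := by
      have := le_abs_self (A.f0 v)
      linarith
    nlinarith
  have aux : ∀ a b c : ℝ, 0 < a * b → (0 < b * c ↔ 0 < a * c) := by
    intro a b c hab
    have e : (a * b) * (b * c) = (b * b) * (a * c) := by ring
    have hbb : 0 < b * b := mul_self_pos.2 fun h => by simp [h] at hab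
    constructor
    · intro h
      have := mul_pos hab h
      rw [e] at this
      exact (mul_pos_iff_of_pos_left hbb).1 this
    · intro h
      have := mul_pos hbb h
      rw [← e] at this
      exact (mul_pos_iff_of_pos_left hab).1 this
  ext y
  constructor
  · intro hy
    exact ⟨fun j => (aux _ _ _ (hin j)).1 (hy j.1), fun j hj => (aux _ _ _ (hout j hj)).1 (hy j)⟩
  · rintro ⟨h1, h2⟩ j
    by_cases hj : j ∈ X.1
    · exact (aux _ _ _ (hin ⟨j, hj⟩)).2 (h1 ⟨j, hj⟩)
    · exact (aux _ _ _ (hout j hj)).2 (h2 j hj)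

lemma exists_isDomainAt (X : A.Vertex) : ∃ Δ, A.IsDomainAt X Δ := by
  set w : Fin k → ℝ := ∑ j, (1 : ℝ) • A.edge X j with hw
  have hlw : ∀ i : {j // j ∈ X.1}, A.l i.1 w = A.l i.1 (A.edge X i) := fun i => by
    rw [hw, A.l_sum_edge X (fun _ => 1) i, one_mul]
  have hpt : ∀ ε : ℝ, 0 < ε →
      (∀ j ∉ X.1, 0 < A.f j (A.point X) * A.f j (A.point X + ε • w)) →
      A.point X + ε • w ∈ {y | (∀ j : {j // j ∈ X.1}, 0 < A.l j.1 (A.edge X j) * A.f j.1 y) ∧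
        ∀ j ∉ X.1, 0 < A.f j (A.point X) * A.f j y} := by
    intro ε hε h
    refine ⟨fun j => ?_, h⟩
    rw [A.f_add, A.f_point X j.2, zero_add, map_smul, hlw, smul_eq_mul]
    have := mul_self_pos.2 (A.l_edge_self X j)
    nlinarith [mul_pos hε this]
  obtain ⟨ε, hε, -, hs⟩ := A.exists_small X w 1 one_pos
  set x := A.point X + ε • w with hx
  have hxm := hpt ε hε hs
  have hxc : x ∈ A.compl := by
    intro j h0
    by_cases hj : j ∈ X.1
    · have := hxm.1 ⟨j, hj⟩
      rw [← hx, h0, mul_zero] at this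
      exact lt_irrefl _ this
    · have := hxm.2 j hj
      rw [← hx, h0, mul_zero] at this
      exact lt_irrefl _ this
  have aux : ∀ a b c : ℝ, 0 < a * b → 0 < a * c → 0 < b * c := by
    intro a b c hab hac
    have e : (a * b) * (a * c) = (a * a) * (b * c) := by ring
    have haa : 0 < a * a := mul_self_pos.2 fun h => by simp [h] at hab
    have := mul_pos hab hac
    rw [e] at this
    exact (mul_pos_iff_of_pos_left haa).1 this
  have hsub : ∀ y, y ∈ {y | (∀ j : {j // j ∈ X.1}, 0 < A.l j.1 (A.edge X j) * A.f j.1 y) ∧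
        ∀ j ∉ X.1, 0 < A.f j (A.point X) * A.f j y} → ∀ j, 0 < A.f j x * A.f j y := by
    rintro y ⟨h1, h2⟩ j
    by_cases hj : j ∈ X.1
    · exact aux _ _ _ (hxm.1 ⟨j, hj⟩) (h1 ⟨j, hj⟩)
    · exact aux _ _ _ (hxm.2 j hj) (h2 j hj)
  have hXne : Nonempty {j // j ∈ X.1} := by
    have : 0 < X.1.card := by rw [X.2]; exact A.k_pos
    obtain ⟨j, hj⟩ := Finset.card_pos.1 this
    exact ⟨⟨j, hj⟩⟩
  refine ⟨connectedComponentIn A.compl x, ⟨x, hxc, rfl⟩, ?_, ?_⟩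
  · rw [A.component_eq hxc]
    refine ⟨?_, fun hint => ?_⟩
    · rw [mem_closure_iff_seq_limit]
      have hex : ∀ n : ℕ, ∃ δ : ℝ, 0 < δ ∧ δ < 1 / ((n : ℝ) + 1) ∧
          ∀ j ∉ X.1, 0 < A.f j (A.point X) * A.f j (A.point X + δ • w) := fun n =>
        A.exists_small X w _ (by positivity)
      choose δ hδ0 hδ1 hδ2 using hex
      refine ⟨fun n => A.point X + δ n • w, fun n => hsub _ (hpt _ (hδ0 n) (hδ2 n)), ?_⟩
      have hδ : Tendsto δ atTop (𝓝 0) :=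
        squeeze_zero (fun n => (hδ0 n).le) (fun n => (hδ1 n).le)
          tendsto_one_div_add_atTop_nhds_zero_nat
      have := (hδ.smul_const w).const_add (A.point X)
      simpa using this
    · obtain ⟨j⟩ := hXne
      have := interior_subset hint j.1
      rw [A.f_point X j.2, mul_zero] at this
      exact lt_irrefl _ this
  · rw [A.component_eq hxc]
    intro y hy
    have h1 : A.f0 y - A.f0 (A.point X) = A.f0 (y - A.point X) := by rw [map_sub]
    have h2 : 0 < A.f0 (y - A.point X) := by
      rw [A.f0_eq_sum X]
      refine Finset.sum_pos (fun j _ => ?_) Finset.univ_nonempty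
      have hl : A.l j.1 (y - A.point X) = A.f j.1 y := by
        have := A.f_add j.1 (A.point X) (y - A.point X)
        rw [add_sub_cancel, A.f_point X j.2, zero_add] at this
        exact this.symm
      rw [hl]
      have h3 : 0 < A.l j.1 (A.edge X j) * A.f j.1 y :=
        aux _ _ _ (by rw [mul_comm]; exact hxm.1 j) (hy j.1)
      rw [div_eq_mul_inv]
      have h4 : 0 < (A.l j.1 (A.edge X j))⁻¹ * (A.l j.1 (A.edge X j))⁻¹ :=
        mul_self_pos.2 (inv_ne_zero (A.l_edge_self X j))
      have h5 := mul_pos h4 h3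
      have h6 : (A.l j.1 (A.edge X j))⁻¹ * (A.l j.1 (A.edge X j))⁻¹ *
          (A.l j.1 (A.edge X j) * A.f j.1 y) = A.f j.1 y * (A.l j.1 (A.edge X j))⁻¹ := by
        have := A.l_edge_self X j
        field_simp
      rwa [h6] at h5
    linarith

/-- There is exactly one domain adjacent to `X` on which `f0 > f0(X)`. -/
lemma existsUnique_isDomainAt (X : A.Vertex) : ∃! Δ, A.IsDomainAt X Δ := by
  obtain ⟨Δ, hΔ⟩ := A.exists_isDomainAt X
  exact ⟨Δ, hΔ, fun Δ' hΔ' => by rw [A.isDomainAt_signs X hΔ', ← A.isDomainAt_signs X hΔ]⟩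

/-- The domain `Δ_X`. -/
def domainAt (X : A.Vertex) : Set (Fin k → ℝ) := (A.existsUnique_isDomainAt X).choose

lemma domainAt_spec (X : A.Vertex) : A.IsDomainAt X (A.domainAt X) :=
  (A.existsUnique_isDomainAt X).choose_spec.1

/-! ### Complexification, and the branches of the integrands -/

/-- The complex-linear extension to `ℂ^k` of a linear form on `ℝ^k`. -/
def complexify (φ : (Fin k → ℝ) →ₗ[ℝ] ℝ) (z : Fin k → ℂ) : ℂ :=
  ∑ i, z i * (φ (Pi.single i 1) : ℂ)

/-- The extension of `f j` to `ℂ^k`. -/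
def fC (j : Fin N) (z : Fin k → ℂ) : ℂ := (A.f j 0 : ℂ) + complexify (A.l j) z

/-- The inclusion of `ℝ^k` in `ℂ^k`. -/
def incl (x : Fin k → ℝ) : Fin k → ℂ := fun i => (x i : ℂ)

/-- The rotation `x ↦ X + ρ (x - X)`. -/
def rotate (X : A.Vertex) (ρ : ℂ) (x : Fin k → ℝ) : Fin k → ℂ :=
  incl (A.point X) + ρ • incl (x - A.point X)

/-- The rotated cone `C_X^ρ = {X + ρ ∑ a j • e_{X \ {j}}, a j > 0}` in `ℂ^k`. -/
def rotatedCone (X : A.Vertex) (ρ : ℂ) : Set (Fin k → ℂ) := A.rotate X ρ '' A.cone X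

lemma complexify_incl (φ : (Fin k → ℝ) →ₗ[ℝ] ℝ) (x : Fin k → ℝ) :
    complexify φ (incl x) = (φ x : ℂ) := by
  have h : x = ∑ i, x i • (Pi.single i 1 : Fin k → ℝ) := pi_eq_sum_univ' x
  conv_rhs => rw [h]
  simp [complexify, incl]

lemma complexify_add (φ : (Fin k → ℝ) →ₗ[ℝ] ℝ) (z w : Fin k → ℂ) :
    complexify φ (z + w) = complexify φ z + complexify φ w := by
  simp [complexify, add_mul, Finset.sum_add_distrib]

lemma complexify_smul (φ : (Fin k → ℝ) →ₗ[ℝ] ℝ) (c : ℂ) (z : Fin k → ℂ) :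
    complexify φ (c • z) = c * complexify φ z := by
  simp [complexify, Finset.mul_sum, mul_assoc]

lemma fC_incl (j : Fin N) (x : Fin k → ℝ) : A.fC j (incl x) = (A.f j x : ℂ) := by
  have := A.f_add j 0 x
  rw [zero_add] at this
  rw [fC, complexify_incl, this, Complex.ofReal_add]

lemma fC_rotate (X : A.Vertex) (ρ : ℂ) (j : Fin N) (x : Fin k → ℝ) :
    A.fC j (A.rotate X ρ x) = (A.f j (A.point X) : ℂ) + ρ * (A.l j (x - A.point X) : ℂ) := by
  rw [← A.fC_incl, fC, fC, rotate, complexify_add, complexify_smul, complexify_incl _ (x - _),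
    add_assoc]

/-- `Φ` is a determination of `∏ j, |f j| ^ α j` around the cones `C_X^ρ`, where `|ρ| = 1` and
`Im ρ` has the sign of `σ`: it is analytic on a domain of `ℂ^k` which contains these cones and
`Δ_X` and avoids the complexified hyperplanes, and on `Δ_X` it is the real function
`∏ j, |f j| ^ α j`. Such a `Φ` is unique on the union of the cones, as they and `Δ_X` form a
connected set. -/
def IsBranch (X : A.Vertex) (σ : ℝ) (Φ : (Fin k → ℂ) → ℂ) : Prop :=
  ∃ D : Set (Fin k → ℂ), IsOpen D ∧ IsConnected D ∧ (∀ z ∈ D, ∀ j, A.fC j z ≠ 0) ∧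
    (∀ ρ : ℂ, ‖ρ‖ = 1 → 0 < σ * ρ.im → A.rotatedCone X ρ ⊆ D) ∧
    incl '' A.domainAt X ⊆ D ∧ AnalyticOnNhd ℂ Φ D ∧
    ∀ x ∈ A.domainAt X, Φ (incl x) = ((∏ j, |A.f j x| ^ A.α j : ℝ) : ℂ)

lemma analyticAt_fC (j : Fin N) (z : Fin k → ℂ) : AnalyticAt ℂ (A.fC j) z := by
  unfold fC complexify
  refine analyticAt_const.add (Finset.analyticAt_fun_sum _ fun i _ => ?_)
  exact ((ContinuousLinearMap.proj (R := ℂ) (φ := fun _ : Fin k => ℂ) i).analyticAt z).mul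
    analyticAt_const

lemma exists_isBranch (X : A.Vertex) (σ : ℝ) : ∃ Φ, A.IsBranch X σ Φ := by
  have hspec := A.domainAt_spec X
  have hsig := A.isDomainAt_signs X hspec
  obtain ⟨⟨x, hx, hΔ⟩, -, -⟩ := hspec
  have hxΔ : x ∈ A.domainAt X := by rw [hΔ]; exact mem_connectedComponentIn hx
  rw [A.component_eq hx] at hΔ
  have hxs := hxΔ
  rw [hsig] at hxs
  set s : Fin N → ℝ := fun j => Real.sign (A.f j x) with hs
  have hs_mul : ∀ j y, 0 < A.f j x * y → s j * y = |y| := by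
    intro j y h
    rcases lt_or_gt_of_ne (hx j) with h1 | h1
    · have hy : y < 0 := by nlinarith
      simp only [hs]
      rw [Real.sign_of_neg h1, abs_of_neg hy, neg_one_mul]
    · have hy : 0 < y := by nlinarith
      simp only [hs]
      rw [Real.sign_of_pos h1, abs_of_pos hy, one_mul]
  have hs0 : ∀ j, s j ≠ 0 := fun j => by
    simp only [hs]
    rw [Ne, Real.sign_eq_zero_iff]
    exact hx j
  have hslit : ∀ j, ∀ y ∈ A.domainAt X, (s j : ℂ) * A.fC j (incl y) = ((|A.f j y| : ℝ) : ℂ) ∧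
      0 < |A.f j y| := by
    intro j y hy
    rw [hΔ] at hy
    rw [A.fC_incl, ← Complex.ofReal_mul, hs_mul j _ (hy j)]
    refine ⟨rfl, abs_pos.2 fun h => ?_⟩
    have := hy j
    rw [h, mul_zero] at this
    exact lt_irrefl _ this
  set D : Set (Fin k → ℂ) := {z | ∀ j, (s j : ℂ) * A.fC j z ∈ Complex.slitPlane} with hD
  have hincl : incl '' A.domainAt X ⊆ D := by
    rintro _ ⟨y, hy, rfl⟩ j
    rw [(hslit j y hy).1, Complex.ofReal_mem_slitPlane]
    exact (hslit j y hy).2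
  have hcont : ∀ j, Continuous (A.fC j) := fun j =>
    continuous_iff_continuousAt.2 fun z => (A.analyticAt_fC j z).continuousAt
  refine ⟨fun z => ∏ j, ((s j : ℂ) * A.fC j z) ^ (A.α j : ℂ), D, ?_, ⟨⟨_, hincl ⟨x, hxΔ, rfl⟩⟩, ?_⟩,
    ?_, ?_, hincl, ?_, ?_⟩
  · rw [hD, Set.ofPred_forall]
    exact isOpen_iInter_of_finite fun j =>
      Complex.isOpen_slitPlane.preimage (continuous_const.mul (hcont j))
  · refine (StarConvex.isPathConnected (a := incl x) ?_ ?_).isConnected.isPreconnected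
    · intro z hz a b ha hb hab j
      have hstar := Complex.starConvex_ofReal_slitPlane (hslit j x hxΔ).2 (hz j) ha hb hab
      rw [← (hslit j x hxΔ).1] at hstar
      have e : (s j : ℂ) * A.fC j (a • incl x + b • z) =
          a • ((s j : ℂ) * A.fC j (incl x)) + b • ((s j : ℂ) * A.fC j z) := by
        have hab' : (a : ℂ) + b = 1 := by exact_mod_cast hab
        have e1 : a • incl x + b • z = (a : ℂ) • incl x + (b : ℂ) • z := by
          ext i; simp
        rw [e1, fC, fC, fC, complexify_add, complexify_smul, complexify_smul,
          Complex.real_smul, Complex.real_smul]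
        linear_combination (-(s j : ℂ) * (A.f j 0 : ℂ)) * hab'
      rw [e]
      exact hstar
    · exact hincl ⟨x, hxΔ, rfl⟩
  · intro z hz j h0
    have := Complex.slitPlane_ne_zero (hz j)
    rw [h0, mul_zero] at this
    exact this rfl
  · rintro ρ - hρ _ ⟨y, ⟨a, ha, hy⟩, rfl⟩ j
    have hρ0 : ρ.im ≠ 0 := fun h => by rw [h, mul_zero] at hρ; exact lt_irrefl _ hρ
    rw [A.fC_rotate]
    by_cases hl : A.l j (y - A.point X) = 0
    · have hj : j ∉ X.1 := by
        intro hj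
        rw [hy, add_sub_cancel_left, A.l_sum_edge X a ⟨j, hj⟩] at hl
        exact mul_ne_zero (ha _).ne' (A.l_edge_self X ⟨j, hj⟩) hl
      have := hxs.2 j hj
      rw [hl, Complex.ofReal_zero, mul_zero, add_zero, ← Complex.ofReal_mul,
        hs_mul j _ (by rw [mul_comm]; exact this), Complex.ofReal_mem_slitPlane]
      exact abs_pos.2 (A.f_point_ne X hj)
    · refine Complex.mem_slitPlane_iff.2 (Or.inr ?_)
      simp [hs0 j, hρ0, hl, -map_sub]
  · intro z hz
    refine Finset.analyticAt_fun_prod _ fun j _ => ?_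
    exact (analyticAt_const.mul (A.analyticAt_fC j z)).cpow analyticAt_const (hz j)
  · intro y hy
    rw [Complex.ofReal_prod]
    refine Finset.prod_congr rfl fun j _ => ?_
    rw [(hslit j y hy).1, Complex.ofReal_cpow (abs_nonneg _)]

/-- The determination of `∏ j, |f j| ^ α j` used on the cones `C_X^ρ` with `Im ρ` of the sign
of `σ`. -/
def branch (X : A.Vertex) (σ : ℝ) : (Fin k → ℂ) → ℂ := (A.exists_isBranch X σ).choose

lemma branch_spec (X : A.Vertex) (σ : ℝ) : A.IsBranch X σ (A.branch X σ) :=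
  (A.exists_isBranch X σ).choose_spec

/-! ### The integrals -/

/-- The vectors of the standard basis of `ℝ^k`, in `ℂ^k`. -/
def stdVec (s : Fin k) : Fin k → ℂ := incl (Pi.single s 1)

/-- The value of `df_{j_1} ∧ ⋯ ∧ df_{j_k}` on `(w 1, …, w k)`, for `X = {j_1 < ⋯ < j_k}`. -/
def wedge (X : A.Vertex) (w : Fin k → Fin k → ℂ) : ℂ :=
  Matrix.det (Matrix.of fun r s => complexify (A.l (X.1.orderEmbOfFin X.2 r)) (w s))

/-- The sign of `df_{j_1} ∧ ⋯ ∧ df_{j_k}` for the standard orientation,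
for `X = {j_1 < ⋯ < j_k}`. -/
def orientSign (X : A.Vertex) : ℝ :=
  Real.sign (Matrix.det (Matrix.of fun r s : Fin k =>
    A.l (X.1.orderEmbOfFin X.2 r) (Pi.single s (1 : ℝ))))

/-- The value at `z` of the `k`-form `ω_X = df_{j_1} / f_{j_1} ∧ ⋯ ∧ df_{j_k} / f_{j_k}` on
`(w 1, …, w k)`, with `X = {j_1, …, j_k}` ordered so that `df_{j_1} ∧ ⋯ ∧ df_{j_k}` is
positively oriented. -/
def omega (X : A.Vertex) (z : Fin k → ℂ) (w : Fin k → Fin k → ℂ) : ℂ :=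
  (∏ j ∈ X.1, A.fC j z)⁻¹ * ((A.orientSign X : ℂ) * A.wedge X w)

/-- The density on `ℝ^k` of the form `e^{-λ f0} (∏ j, |f j| ^ α j) ω_X`. -/
def domainIntegrand (lam : ℂ) (X : A.Vertex) (x : Fin k → ℝ) : ℂ :=
  Complex.exp (-lam * (A.f0 x : ℂ)) * ((∏ j, |A.f j x| ^ A.α j : ℝ) : ℂ) *
    A.omega X (incl x) stdVec

/-- The vector `I_Δ(λ)`, with components `∫_Δ e^{-λ f0} (∏ j, |f j| ^ α j) ω_X`. -/
def integralDomain (Δ : Set (Fin k → ℝ)) (lam : ℂ) : A.Vertex → ℂ :=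
  fun X => ∫ x in Δ, A.domainIntegrand lam X x

/-- The density on the cone `C_X^+` of the pullback under `x ↦ X + ρ (x - X)` of the form
`e^{-λ f0} (∏ j, |f j| ^ α j) ω_{X'}` on `C_X^ρ`, for `ρ` not real. -/
def coneIntegrand (X : A.Vertex) (ρ lam : ℂ) (X' : A.Vertex) (x : Fin k → ℝ) : ℂ :=
  Complex.exp (-lam * complexify A.f0 (A.rotate X ρ x)) *
    A.branch X (Real.sign ρ.im) (A.rotate X ρ x) *
    A.omega X' (A.rotate X ρ x) fun s => ρ • stdVec s

/-- The vector `I_X^ρ(λ)`, with components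
`∫_{C_X^ρ} e^{-λ f0} (∏ j, |f j| ^ α j) ω_{X'}`. -/
def integralCone (X : A.Vertex) (ρ lam : ℂ) : A.Vertex → ℂ :=
  fun X' => ∫ x in A.cone X, A.coneIntegrand X ρ lam X' x

/-- The vector `I_X^+(λ)`: the common value of `I_X^ρ(λ)` for `|ρ| = 1`, `Im ρ < 0` and
`Re (ρ λ) > 0`. -/
def integralPlus (X : A.Vertex) (lam : ℂ) : A.Vertex → ℂ :=
  Classical.epsilon fun c =>
    ∀ ρ : ℂ, ‖ρ‖ = 1 → ρ.im < 0 → 0 < (ρ * lam).re → A.integralCone X ρ lam = c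

/-- The vector `I_X^-(λ)`: the common value of `I_X^ρ(λ)` for `|ρ| = 1`, `Im ρ > 0` and
`Re (ρ λ) > 0`. -/
def integralMinus (X : A.Vertex) (lam : ℂ) : A.Vertex → ℂ :=
  Classical.epsilon fun c =>
    ∀ ρ : ℂ, ‖ρ‖ = 1 → 0 < ρ.im → 0 < (ρ * lam).re → A.integralCone X ρ lam = c

/-! ### The coefficients -/

open Classical in
/-- The (indices of the) hyperplanes that separate `Δ` from `Δ'`. -/
def separating (Δ Δ' : Set (Fin k → ℝ)) : Finset (Fin N) :=
  {j | ∀ x ∈ Δ, ∀ y ∈ Δ', A.f j x * A.f j y < 0}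

/-- `α_U = ∑ j ∈ U, α j`. -/
def weight (U : Finset (Fin N)) : ℝ := ∑ j ∈ U, A.α j

open Classical in
/-- The coefficient `ψ(Δ, X)`. -/
def psi (Δ : Set (Fin k → ℝ)) (X : A.Vertex) : ℂ :=
  if Δ = A.domainAt X then 1
  else (-1) ^ (A.separating Δ (A.domainAt X)).card *
    Complex.exp (Complex.I * Real.pi * A.weight (A.separating Δ (A.domainAt X)))

open Classical in
/-- The vertices in the boundary of `Δ`. -/
def boundaryVertices (Δ : Set (Fin k → ℝ)) : Finset A.Vertex :=
  {X | A.point X ∈ frontier Δ}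

end Arrangement

end

/-!
For almost every `x`, the indicator of `Δ` at `x` is the sum over the vertices `X` of `Δ` of
`(-1) ^ |H(Δ, Δ_X)|` times the indicator of the cone `C_X^+`. Indeed, for a generic linear form `g`
bounded below on `Δ`, a face of `Δ` has a unique vertex at which `g` is minimal, and this turns the
signed count of vertices into an alternating sum over faces, which does not depend on `g`. If `x` is
not in `Δ`, adding to a multiple of `f0` a form that is negative at `x` and nonnegative on `Δ` makes
the value at `x` smaller than the minimum over `Δ`, and then the count has no terms.

The integral over the image of a cone under `x ↦ X + t (x - X)` is holomorphic in `t` and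
invariant under positive dilations of `t`, hence constant for `t` in a sector. Letting `t` tend to
`1` gives the integral over the real cone of `e^{-λ f0} (∏ j, |f j| ^ α j) ω_{X'}` times a phase,
locally constant off the hyperplanes. On each cone this phase times the exponential factor of
`ψ(Δ, X)`, or of its conjugate, does not depend on `X` and is `1` on `Δ`, so the expansion of the
indicator can be integrated.
-/

lemma mul_pos_iff_mul_pos {R : Type*} [Ring R] [LinearOrder R] [IsStrictOrderedRing R]
    {a b : R} (h : 0 < a * b) (c : R) : 0 < a * c ↔ 0 < b * c := by
  obtain ⟨ha, hb⟩ | ⟨ha, hb⟩ := pos_and_pos_or_neg_and_neg_of_mul_pos h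
  · rw [mul_pos_iff_of_pos_left ha, mul_pos_iff_of_pos_left hb]
  · rw [← neg_mul_neg a, ← neg_mul_neg b, mul_pos_iff_of_pos_left (neg_pos.2 ha),
      mul_pos_iff_of_pos_left (neg_pos.2 hb)]

lemma mul_neg_iff_mul_neg {R : Type*} [CommRing R] [LinearOrder R] [IsStrictOrderedRing R]
    {a b c d : R} (h : 0 < a * b) (h' : 0 < c * d) : a * c < 0 ↔ b * d < 0 :=
  neg_iff_neg_of_mul_pos (by rw [mul_mul_mul_comm]; exact mul_pos h h')

lemma mul_pos_iff_neg_iff_neg {R : Type*} [CommRing R] [LinearOrder R] [IsStrictOrderedRing R]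
    {a b c : R} (ha : a ≠ 0) (hb : b ≠ 0) (hc : c ≠ 0) : 0 < b * c ↔ (a * b < 0 ↔ a * c < 0) := by
  rcases ha.lt_or_gt with ha | ha <;> rcases hb.lt_or_gt with hb | hb <;>
    rcases hc.lt_or_gt with hc | hc <;> simp [mul_pos_iff, mul_neg_iff, *, not_lt_of_gt]

lemma sum_Icc_neg_one_pow_card {ι : Type*} [DecidableEq ι] (B C : Finset ι) :
    ∑ T ∈ Finset.Icc B C, (-1 : ℤ) ^ T.card = if B = C then (-1) ^ C.card else 0 := by
  by_cases hBC : B ⊆ C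
  · have hdisj : ∀ R ∈ (C \ B).powerset, Disjoint B R := fun R hR =>
      Finset.disjoint_sdiff.mono_right (Finset.mem_powerset.1 hR)
    have hinj : Set.InjOn (B ∪ ·) ((C \ B).powerset : Set (Finset ι)) := fun R hR R' hR' h => by
      simpa [Finset.union_sdiff_cancel_left (hdisj R hR),
        Finset.union_sdiff_cancel_left (hdisj R' hR')] using congrArg (· \ B) h
    rw [Finset.Icc_eq_image_powerset hBC, Finset.sum_image hinj, Finset.sum_congr rfl
      fun R hR => by rw [Finset.card_union_of_disjoint (hdisj R hR), pow_add],
      ← Finset.mul_sum, Finset.sum_powerset_neg_one_pow_card]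
    by_cases h : B = C
    · simp [h]
    · rw [if_neg h, if_neg fun h' => h (hBC.antisymm (Finset.sdiff_eq_empty_iff_subset.1 h')),
        mul_zero]
  · rw [Finset.Icc_eq_empty hBC, Finset.sum_empty, if_neg fun h => hBC h.subset]

lemma isPreconnected_insert_setOf_mul_im_pos {σ : ℝ} (hσ : σ ≠ 0) (r : ℝ) :
    IsPreconnected (insert (r : ℂ) {w : ℂ | 0 < σ * w.im}) := by
  have hconv : Convex ℝ {w : ℂ | 0 < σ * w.im} :=
    convex_halfSpace_gt (f := fun w : ℂ => σ * w.im)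
      ⟨fun _ _ => by simp [mul_add], fun _ _ => by simp [mul_left_comm]⟩ 0
  have hlim : Tendsto (fun t : ℝ => (r : ℂ) + t * (σ * Complex.I)) (𝓝[>] 0) (𝓝 r) := by
    have hcont : Continuous fun t : ℝ => (r : ℂ) + t * (σ * Complex.I) := by fun_prop
    simpa using (hcont.tendsto 0).mono_left nhdsWithin_le_nhds
  have hmem : (r : ℂ) ∈ closure {w : ℂ | 0 < σ * w.im} := by
    refine mem_closure_of_tendsto hlim ?_
    filter_upwards [self_mem_nhdsWithin] with t (ht : 0 < t)
    have hpos : 0 < t * (σ * σ) := mul_pos ht (mul_self_pos.2 hσ)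
    simpa [mul_left_comm, mul_comm] using hpos
  exact hconv.isPreconnected.subset_closure (subset_insert _ _)
    (insert_subset hmem subset_closure)

lemma integrable_abs_rpow_mul_exp {s η : ℝ} (hs : -1 < s) (hη : 0 < η) :
    Integrable fun y : ℝ => |y| ^ s * Real.exp (-η * |y|) := by
  have hpos : IntegrableOn (fun y : ℝ => |y| ^ s * Real.exp (-η * |y|)) (Ioi 0) := by
    refine (integrableOn_rpow_mul_exp_neg_mul_rpow hs one_pos hη).congr_fun (fun y hy => ?_)
      measurableSet_Ioi
    simp only [Real.rpow_one, abs_of_pos (mem_Ioi.1 hy)]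
  have hneg : IntegrableOn (fun y : ℝ => |y| ^ s * Real.exp (-η * |y|)) (Iic 0) := by
    rw [← integrableOn_Ici_iff_integrableOn_Ioi enorm_ne_top, ← neg_zero] at hpos
    simpa using hpos.comp_neg_Iic
  rw [← integrableOn_univ, ← Iic_union_Ioi (a := (0 : ℝ))]
  exact hneg.union hpos

lemma rpow_le_mul_exp {m b p : ℝ} (hm : 0 < m) (hb : 0 < b) (hp : 0 ≤ p) :
    p ^ m ≤ (m / b) ^ m * Real.exp (b * p) := by
  have hle : p ≤ m / b * Real.exp (b * p / m) :=
    calc p = m / b * (b * p / m) := by field_simp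
      _ ≤ m / b * Real.exp (b * p / m) := by
        gcongr
        linarith [Real.add_one_le_exp (b * p / m)]
  calc p ^ m ≤ (m / b * Real.exp (b * p / m)) ^ m := by gcongr
    _ = (m / b) ^ m * Real.exp (b * p) := by
      rw [Real.mul_rpow (by positivity) (Real.exp_pos _).le, ← Real.exp_mul,
        div_mul_cancel₀ _ hm.ne']

lemma rpow_mul_inv_le {α u v p : ℝ} (hα : 0 < α) (hv : 0 < v) (hvu : v ≤ u) (hup : u ≤ p)
    (hp : 1 ≤ p) : u ^ α * u⁻¹ ≤ p ^ α * v ^ (min α 1 - 1) := by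
  have hu : 0 < u := hv.trans_le hvu
  have hmin : 0 < min α 1 := lt_min hα one_pos
  calc u ^ α * u⁻¹ = u ^ (α - min α 1) * u ^ (min α 1 - 1) := by
        rw [← Real.rpow_neg_one u, ← Real.rpow_add hu, ← Real.rpow_add hu]
        ring_nf
    _ ≤ p ^ (α - min α 1) * v ^ (min α 1 - 1) := by
        gcongr ?_ * ?_
        · exact Real.rpow_le_rpow hu.le hup (sub_nonneg.2 (min_le_left _ _))
        · exact Real.rpow_le_rpow_of_nonpos hv hvu (sub_nonpos.2 (min_le_right _ _))
    _ ≤ p ^ α * v ^ (min α 1 - 1) := by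
        gcongr
        linarith

lemma exp_neg_mul_le_mul_exp {c δ τ K M h : ℝ} (hc : 0 ≤ c) (hK : 0 < K) (hM : 0 < M) (hh : 0 ≤ h)
    (hτ : δ ≤ τ) :
    Real.exp (-c * τ * h) ≤
      Real.exp (c * δ / M) * Real.exp (-(2 * (c * δ / (2 * (K * M))) * (K * (1 + M * h)))) := by
  rw [← Real.exp_add, Real.exp_le_exp]
  calc -c * τ * h ≤ -(c * δ * h) := by
        rw [neg_mul, neg_mul, neg_le_neg_iff]
        gcongr
    _ = c * δ / M + -(2 * (c * δ / (2 * (K * M))) * (K * (1 + M * h))) := by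
        field_simp
        ring

section ProdBounds

variable {ι : Type*}

lemma prod_rpow_mul_prod_inv_le [Fintype ι] {α u v : ι → ℝ} {p : ℝ} (S : Finset ι)
    (hα : ∀ i, 0 < α i) (hv : ∀ i, 0 < v i) (hvu : ∀ i, v i ≤ u i) (hup : ∀ i, u i ≤ p)
    (hp : 1 ≤ p) :
    (∏ i, u i ^ α i) * ∏ i ∈ S, (u i)⁻¹ ≤
      p ^ (∑ i, α i) * ∏ i ∈ S, v i ^ (min (α i) 1 - 1) := by
  classical
  have hu : ∀ i, 0 < u i := fun i => (hv i).trans_le (hvu i)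
  have hextend : ∀ F : ι → ℝ, ∏ i ∈ S, F i = ∏ i, if i ∈ S then F i else 1 := fun F => by
    rw [Finset.prod_ite_mem, Finset.univ_inter]
  rw [hextend, hextend, ← Finset.prod_mul_distrib, Real.rpow_sum_of_pos (by linarith),
    ← Finset.prod_mul_distrib]
  refine Finset.prod_le_prod (fun i _ => ?_) fun i _ => ?_
  · have := hu i
    split_ifs <;> positivity
  · split_ifs
    · exact rpow_mul_inv_le (hα i) (hv i) (hvu i) (hup i) hp
    · rw [mul_one, mul_one]
      exact Real.rpow_le_rpow (hu i).le (hup i) (hα i).le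

lemma exp_neg_mul_le_prod_exp {w : ι → ℝ} {b p : ℝ} {S : Finset ι} (hS : S.Nonempty) (hb : 0 ≤ b)
    (hw : ∀ i, w i ≤ p) : Real.exp (-(b * p)) ≤ ∏ i ∈ S, Real.exp (-(b / S.card) * w i) := by
  have hcard : (S.card : ℝ) ≠ 0 := by exact_mod_cast hS.card_pos.ne'
  rw [← Real.exp_sum, ← Finset.mul_sum, Real.exp_le_exp, neg_mul, neg_le_neg_iff]
  calc b / S.card * ∑ i ∈ S, w i ≤ b / S.card * (S.card * p) := by
        gcongr
        simpa using Finset.sum_le_card_nsmul S w p fun i _ => hw i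
    _ = b * p := by field_simp

lemma exp_mul_prod_rpow_mul_prod_inv_le [Fintype ι] {α u v w : ι → ℝ} {b p : ℝ} {S : Finset ι}
    (hS : S.Nonempty) (hα : ∀ i, 0 < α i) (hv : ∀ i, 0 < v i) (hvu : ∀ i, v i ≤ u i)
    (hup : ∀ i, u i ≤ p) (hwp : ∀ i, w i ≤ p) (hp : 1 ≤ p) (hb : 0 < b) :
    Real.exp (-(2 * b * p)) * ((∏ i, u i ^ α i) * ∏ i ∈ S, (u i)⁻¹) ≤
      ((∑ i, α i) / b) ^ (∑ i, α i) *
        ∏ i ∈ S, v i ^ (min (α i) 1 - 1) * Real.exp (-(b / S.card) * w i) := by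
  have hm : 0 < ∑ i, α i := Finset.sum_pos (fun i _ => hα i) (hS.mono (Finset.subset_univ S))
  have hV : 0 ≤ ∏ i ∈ S, v i ^ (min (α i) 1 - 1) :=
    Finset.prod_nonneg fun i _ => Real.rpow_nonneg (hv i).le _
  calc Real.exp (-(2 * b * p)) * ((∏ i, u i ^ α i) * ∏ i ∈ S, (u i)⁻¹)
      ≤ Real.exp (-(2 * b * p)) * (((∑ i, α i) / b) ^ (∑ i, α i) * Real.exp (b * p) *
          ∏ i ∈ S, v i ^ (min (α i) 1 - 1)) := by
        refine mul_le_mul_of_nonneg_left ?_ (Real.exp_pos _).le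
        refine (prod_rpow_mul_prod_inv_le S hα hv hvu hup hp).trans ?_
        gcongr
        exact rpow_le_mul_exp hm hb (by linarith)
    _ = ((∑ i, α i) / b) ^ (∑ i, α i) *
          ((∏ i ∈ S, v i ^ (min (α i) 1 - 1)) * Real.exp (-(b * p))) := by
        have hexp : Real.exp (-(2 * b * p)) * Real.exp (b * p) = Real.exp (-(b * p)) := by
          rw [← Real.exp_add]
          ring_nf
        rw [← hexp]
        ring
    _ ≤ _ := by
        rw [Finset.prod_mul_distrib]
        gcongr
        exact exp_neg_mul_le_prod_exp hS hb.le hwp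

end ProdBounds

/-- The factors `t` for which the integrands over the image of a cone under `x ↦ X + t (x - X)`
are bounded uniformly, with constants `M` and `δ`. Besides `t` being bounded and `Re t` being
bounded below, they are such that a form at the image of a real point is not smaller than at the
point itself, up to the factor `M`: with `a = f_j X` and `b = l_j (x - X)`, its values there are
`a + t b` and `a + b`. -/
def admissible (M δ : ℝ) : Set ℂ :=
  {t | ‖t‖ ≤ M ∧ δ ≤ t.re ∧ ∀ a b : ℝ, |a + b| ≤ M * ‖a + t * b‖}

section ParametricIntegral

variable {β E : Type*} [MeasurableSpace β] {μ : Measure β} [NormedAddCommGroup E]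

lemma aestronglyMeasurable_of_hasDerivAt {𝕜 : Type*} [NontriviallyNormedField 𝕜]
    [NormedSpace 𝕜 E] {F : 𝕜 → β → E} {F' : β → E} {t₀ : 𝕜}
    (hmeas : ∀ᶠ t in 𝓝 t₀, AEStronglyMeasurable (F t) μ)
    (hderiv : ∀ᵐ a ∂μ, HasDerivAt (fun t => F t a) (F' a) t₀) : AEStronglyMeasurable F' μ := by
  obtain ⟨u, hu⟩ := exists_seq_tendsto (𝓝[≠] t₀)
  obtain ⟨n₀, hn₀⟩ := eventually_atTop.1 (hu.eventually (nhdsWithin_le_nhds hmeas))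
  refine aestronglyMeasurable_of_tendsto_ae atTop
    (f := fun n a => slope (fun t => F t a) t₀ (u (n + n₀))) (fun n => ?_) ?_
  · exact ((hn₀ _ (Nat.le_add_left n₀ n)).sub hmeas.self_of_nhds).const_smul _
  · filter_upwards [hderiv] with a ha
    exact (hasDerivAt_iff_tendsto_slope.1 ha).comp (hu.comp (tendsto_add_atTop_nat n₀))

lemma differentiableAt_integral_of_dominated [NormedSpace ℂ E] {F : ℂ → β → E} {t₀ : ℂ}
    {U : Set ℂ} (hU : U ∈ 𝓝 t₀) {B : β → ℝ} (hB : Integrable B μ)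
    (hmeas : ∀ t ∈ U, AEStronglyMeasurable (F t) μ)
    (hdiff : ∀ᵐ a ∂μ, DifferentiableOn ℂ (fun t => F t a) U)
    (hbound : ∀ᵐ a ∂μ, ∀ t ∈ U, ‖F t a‖ ≤ B a) :
    DifferentiableAt ℂ (fun t => ∫ a, F t a ∂μ) t₀ := by
  obtain ⟨R, hR, hRU⟩ := Metric.mem_nhds_iff.1 hU
  have hsub : ∀ t ∈ Metric.ball t₀ (R / 2), Metric.closedBall t (R / 2) ⊆ U := fun t ht =>
    (Metric.closedBall_subset_ball' (by linarith [Metric.mem_ball.1 ht])).trans hRU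
  have hmem : ∀ t ∈ Metric.ball t₀ (R / 2), U ∈ 𝓝 t := fun t ht =>
    mem_of_superset (Metric.closedBall_mem_nhds t (half_pos hR)) (hsub t ht)
  have hderiv : ∀ᵐ a ∂μ, ∀ t ∈ Metric.ball t₀ (R / 2),
      HasDerivAt (fun t => F t a) (deriv (fun t => F t a) t) t := by
    filter_upwards [hdiff] with a ha t ht using (ha.differentiableAt (hmem t ht)).hasDerivAt
  have hmeas' : ∀ᶠ t in 𝓝 t₀, AEStronglyMeasurable (F t) μ := eventually_of_mem hU hmeas
  have ht₀ : t₀ ∈ Metric.ball t₀ (R / 2) := Metric.mem_ball_self (half_pos hR)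
  refine (hasDerivAt_integral_of_dominated_loc_of_deriv_le
    (F' := fun t a => deriv (fun t => F t a) t) (bound := fun a => B a / (R / 2))
    (Metric.ball_mem_nhds t₀ (half_pos hR)) hmeas' ?_ ?_ ?_ (hB.div_const _)
    hderiv).2.differentiableAt
  · exact hB.mono' hmeas'.self_of_nhds (hbound.mono fun a ha => ha t₀ (mem_of_mem_nhds hU))
  · exact aestronglyMeasurable_of_hasDerivAt hmeas' (hderiv.mono fun a ha => ha t₀ ht₀)
  · filter_upwards [hdiff, hbound] with a ha hb t ht
    refine Complex.norm_deriv_le_of_forall_mem_sphere_norm_le (half_pos hR) ?_ fun z hz =>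
      hb z (hsub t ht (Metric.sphere_subset_closedBall hz))
    exact (ha.mono (hsub t ht)).diffContOnCl_ball subset_rfl

end ParametricIntegral

lemma deriv_eq_zero_of_eventually_eq_dilation {E : Type*} [NormedAddCommGroup E] [NormedSpace ℂ E]
    {J : ℂ → E} {t : ℂ} (ht : t ≠ 0) (hJ : DifferentiableAt ℂ J t)
    (hinv : ∀ᶠ r : ℝ in 𝓝 1, J (r * t) = J t) : deriv J t = 0 := by
  have hline : HasDerivAt (fun r : ℝ => (r : ℂ) * t) t 1 := by
    simpa using (Complex.ofRealCLM.hasDerivAt (x := (1 : ℝ))).mul_const t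
  have hJ' : HasDerivAt J (deriv J t) (((1 : ℝ) : ℂ) * t) := by
    rw [Complex.ofReal_one, one_mul]
    exact hJ.hasDerivAt
  have hzero : HasDerivAt (fun r : ℝ => J (r * t)) 0 1 :=
    (hasDerivAt_const (1 : ℝ) (J t)).congr_of_eventuallyEq hinv
  exact (smul_eq_zero.1 ((hJ'.scomp (1 : ℝ) hline).unique hzero)).resolve_left ht

/-- The sector of the factors `t` with `0 < Re t` and `Im t` of the sign of `σ`, over which the
integrals do not depend on `t`. -/
def sector (σ : ℝ) : Set ℂ := {t | 0 < t.re ∧ 0 < σ * t.im}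

lemma isOpen_sector (σ : ℝ) : IsOpen (sector σ) :=
  (isOpen_lt continuous_const Complex.continuous_re).inter
    (isOpen_lt continuous_const (continuous_const.mul Complex.continuous_im))

lemma convex_sector (σ : ℝ) : Convex ℝ (sector σ) :=
  (convex_halfSpace_re_gt 0).inter (convex_halfSpace_gt (f := fun w : ℂ => σ * w.im)
    ⟨fun _ _ => by simp [mul_add], fun _ _ => by simp [mul_left_comm]⟩ 0)

lemma im_ne_zero_of_mem_sector {σ : ℝ} {t : ℂ} (ht : t ∈ sector σ) : t.im ≠ 0 :=
  right_ne_zero_of_mul ht.2.ne'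

lemma abs_add_le_mul_norm {t : ℂ} (ht : t.im ≠ 0) (a b : ℝ) :
    |a + b| ≤ (1 + ‖1 - t‖ / |t.im|) * ‖a + t * b‖ := by
  have him : |t.im| * |b| ≤ ‖a + t * b‖ := by
    simpa [abs_mul] using Complex.abs_im_le_norm (a + t * b)
  calc |a + b| = ‖(a + t * b) + (1 - t) * b‖ := by
        rw [← Real.norm_eq_abs, ← Complex.norm_real]
        push_cast
        ring_nf
    _ ≤ ‖a + t * b‖ + ‖1 - t‖ * |b| := by
        refine (norm_add_le _ _).trans_eq ?_
        rw [norm_mul, Complex.norm_real, Real.norm_eq_abs]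
    _ ≤ ‖a + t * b‖ + ‖1 - t‖ * (‖a + t * b‖ / |t.im|) := by
        gcongr
        rwa [le_div_iff₀' (abs_pos.2 ht)]
    _ = (1 + ‖1 - t‖ / |t.im|) * ‖a + t * b‖ := by ring

lemma mem_admissible {M δ : ℝ} {t : ℂ} (him : t.im ≠ 0) (hnorm : ‖t‖ ≤ M) (hre : δ ≤ t.re)
    (hM : 1 + ‖1 - t‖ / |t.im| ≤ M) : t ∈ admissible M δ :=
  ⟨hnorm, hre, fun a b => (abs_add_le_mul_norm him a b).trans (by gcongr)⟩

lemma exists_admissible_mem_nhds {t₀ : ℂ} (hre : 0 < t₀.re) (him : t₀.im ≠ 0) :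
    ∃ M δ : ℝ, 1 ≤ M ∧ 0 < δ ∧ admissible M δ ∈ 𝓝 t₀ := by
  set c : ℂ → ℝ := fun t => 1 + ‖1 - t‖ / |t.im|
  have hc : ContinuousAt c t₀ := continuousAt_const.add
    (ContinuousAt.div (by fun_prop) (by fun_prop) (abs_pos.2 him).ne')
  have hc₀ : 1 ≤ c t₀ := le_add_of_nonneg_right (by positivity)
  refine ⟨‖t₀‖ + c t₀ + 1, t₀.re / 2, by linarith [norm_nonneg t₀], half_pos hre, ?_⟩
  filter_upwards [Complex.continuous_im.continuousAt.eventually_ne him,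
    continuous_norm.continuousAt.eventually_lt_const (lt_add_one ‖t₀‖),
    Complex.continuous_re.continuousAt.eventually_const_lt (half_lt_self hre),
    hc.eventually_lt_const (lt_add_one (c t₀))] with t him' hnorm hre' hct
  exact mem_admissible him' (by linarith) hre'.le (by linarith [norm_nonneg t₀])

/- The principal branch of the logarithm jumps across the negative axis, so the limit depends on the
side from which the axis is approached. -/
lemma tendsto_cpow_nhdsWithin_of_neg {σ r : ℝ} (hσ : σ = -1 ∨ σ = 1) (hr : r < 0) (α : ℝ) :
    Tendsto (fun w : ℂ => w ^ (α : ℂ)) (𝓝[{w | σ * w.im < 0}] (r : ℂ))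
      (𝓝 (((|r| ^ α : ℝ) : ℂ) * Complex.exp (-(σ * Complex.I * Real.pi * α)))) := by
  have hlog : Tendsto Complex.log (𝓝[{w | σ * w.im < 0}] (r : ℂ))
      (𝓝 (Real.log |r| - σ * Real.pi * Complex.I)) := by
    rw [← Real.norm_eq_abs, ← Complex.norm_real]
    rcases hσ with rfl | rfl
    · have h := Complex.tendsto_log_nhdsWithin_im_nonneg_of_re_neg_of_im_zero (z := (r : ℂ))
        (by simpa using hr) (Complex.ofReal_im r)
      have hsub : {w : ℂ | (-1 : ℝ) * w.im < 0} ⊆ {w | 0 ≤ w.im} := fun w (hw : -1 * w.im < 0) =>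
        show 0 ≤ w.im by linarith
      exact Tendsto.mono_left (by simpa using h) (nhdsWithin_mono _ hsub)
    · simpa using Complex.tendsto_log_nhdsWithin_im_neg_of_re_neg_of_im_zero (z := (r : ℂ))
        (by simpa using hr) (Complex.ofReal_im r)
  have hlim : ((|r| ^ α : ℝ) : ℂ) * Complex.exp (-(σ * Complex.I * Real.pi * α)) =
      Complex.exp ((Real.log |r| - σ * Real.pi * Complex.I) * α) := by
    rw [Real.rpow_def_of_pos (abs_pos.2 hr.ne), Complex.ofReal_exp, ← Complex.exp_add]
    push_cast
    ring_nf
  rw [hlim]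
  refine (hlog.mul_const (α : ℂ)).cexp.congr' ?_
  filter_upwards [eventually_ne_nhdsWithin (Complex.ofReal_ne_zero.2 hr.ne)] with w hw
  rw [Complex.cpow_def_of_ne_zero hw]

lemma tendsto_one_add_mul_I_nhdsWithin_sector {σ : ℝ} (hσ : σ ≠ 0) :
    Tendsto (fun ε : ℝ => 1 + σ * ε * Complex.I) (𝓝[>] 0) (𝓝[sector σ] 1) := by
  refine tendsto_nhdsWithin_iff.2 ⟨?_, ?_⟩
  · have hcont : Continuous fun ε : ℝ => 1 + σ * ε * Complex.I := by fun_prop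
    simpa using (hcont.tendsto 0).mono_left nhdsWithin_le_nhds
  · filter_upwards [self_mem_nhdsWithin] with ε hε
    refine ⟨by simp, ?_⟩
    simpa [← mul_assoc] using mul_pos (mul_self_pos.2 hσ) hε

lemma one_add_mul_I_mem_admissible {σ ε : ℝ} (hσ : |σ| = 1) (hε : ε ∈ Ioo 0 1) :
    1 + σ * ε * Complex.I ∈ admissible 2 1 := by
  have hnorm : ‖(σ : ℂ) * ε * Complex.I‖ = ε := by simp [hσ, abs_of_pos hε.1]
  have him : |(1 + σ * ε * Complex.I).im| = ε := by simp [hσ, abs_of_pos hε.1]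
  refine mem_admissible (abs_pos.1 (him.symm ▸ hε.1)) ?_ (by simp) ?_
  · refine (norm_add_le _ _).trans ?_
    rw [hnorm, norm_one]
    linarith [hε.2]
  · rw [him, sub_add_cancel_left, norm_neg, hnorm, div_self hε.1.ne', one_add_one_eq_two]

lemma mem_sector_of_re_mul_pos {lam σ : ℝ} {ρ : ℂ} (hlam : 0 < lam) (him : 0 < σ * ρ.im)
    (hre : 0 < (ρ * lam).re) : ρ ∈ sector σ :=
  ⟨pos_of_mul_pos_left (by rwa [Complex.re_mul_ofReal] at hre) hlam.le, him⟩

namespace Arrangement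

variable {k N : ℕ} (A : Arrangement k N)

/-! ### Chambers and cones -/

lemma l_sub (j : Fin N) (x y : Fin k → ℝ) : A.l j (x - y) = A.f j x - A.f j y := by
  rw [eq_sub_iff_add_eq', ← A.f_add, add_sub_cancel]

lemma l_sub_point (X : A.Vertex) {j : Fin N} (hj : j ∈ X.1) (x : Fin k → ℝ) :
    A.l j (x - A.point X) = A.f j x := by
  rw [A.l_sub, A.f_point X hj, sub_zero]

lemma nonempty_indices (X : A.Vertex) : Nonempty {j // j ∈ X.1} :=
  (Finset.card_pos.1 (X.2.symm ▸ A.k_pos)).to_subtype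

lemma eq_point (X : A.Vertex) {y : Fin k → ℝ} (hy : ∀ j ∈ X.1, A.f j y = 0) : y = A.point X :=
  (A.inter_k X.1 X.2).choose_spec.2 y hy

lemma exists_vertex_superset {U : Finset (Fin N)} (hU : U.card ≤ k) :
    ∃ X : A.Vertex, U ⊆ X.1 := by
  obtain ⟨X, hUX, hX⟩ := Finset.exists_superset_card_eq hU (by simpa using A.k_le)
  exact ⟨⟨X, hX⟩, hUX⟩

/-- The open chamber on which each `f j` has the sign of `s j`. -/
def chamber (s : Fin N → ℝ) : Set (Fin k → ℝ) := {x | ∀ j, 0 < s j * A.f j x}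

/-- The closed polyhedron on which each `f j` vanishes or has the sign of `s j`. -/
def polyhedron (s : Fin N → ℝ) : Set (Fin k → ℝ) := {x | ∀ j, 0 ≤ s j * A.f j x}

lemma chamber_subset_compl (s : Fin N → ℝ) : A.chamber s ⊆ A.compl :=
  fun _ hx j => right_ne_zero_of_mul (hx j).ne'

lemma isOpen_chamber (s : Fin N → ℝ) : IsOpen (A.chamber s) := by
  rw [chamber, Set.ofPred_forall]
  exact isOpen_iInter_of_finite fun j =>
    isOpen_lt continuous_const (continuous_const.mul (A.continuous_f j))

lemma isClosed_polyhedron (s : Fin N → ℝ) : IsClosed (A.polyhedron s) := by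
  rw [polyhedron, Set.ofPred_forall]
  exact isClosed_iInter fun j =>
    isClosed_le continuous_const (continuous_const.mul (A.continuous_f j))

lemma closure_chamber {s : Fin N → ℝ} (hs : (A.chamber s).Nonempty) :
    closure (A.chamber s) = A.polyhedron s := by
  obtain ⟨x, hx⟩ := hs
  refine subset_antisymm
    (closure_minimal (fun y hy j => (hy j).le) (A.isClosed_polyhedron s)) fun y hy => ?_
  have hxy : openSegment ℝ x y ⊆ A.chamber s := by
    rintro _ ⟨a, b, ha, hb, hab, rfl⟩ j
    rw [Convex.combo_affine_apply hab, smul_eq_mul, smul_eq_mul]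
    nlinarith [mul_pos ha (hx j), mul_nonneg hb.le (hy j)]
  exact closure_mono hxy (segment_subset_closure_openSegment (right_mem_segment ℝ x y))

lemma mem_boundaryVertices_chamber {s : Fin N → ℝ} (hs : (A.chamber s).Nonempty)
    (X : A.Vertex) : X ∈ A.boundaryVertices (A.chamber s) ↔ A.point X ∈ A.polyhedron s := by
  obtain ⟨j⟩ := A.nonempty_indices X
  have hX : A.point X ∉ A.chamber s := fun h => A.chamber_subset_compl s h j (A.f_point X j.2)
  simp [boundaryVertices, (A.isOpen_chamber s).frontier_eq, A.closure_chamber hs, hX]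

lemma mul_f_point_pos {s : Fin N → ℝ} (hs : ∀ j, s j ≠ 0) {X : A.Vertex}
    (hX : A.point X ∈ A.polyhedron s) {j : Fin N} (hj : j ∉ X.1) :
    0 < s j * A.f j (A.point X) :=
  (hX j).lt_of_ne' (mul_ne_zero (hs j) (A.f_point_ne X hj))

/-- The sign of `f j` on the domain `Δ_X`. -/
noncomputable def side (X : A.Vertex) (j : Fin N) : ℝ :=
  if h : j ∈ X.1 then Real.sign (A.l j (A.edge X ⟨j, h⟩)) else Real.sign (A.f j (A.point X))

lemma side_eq_or (X : A.Vertex) (j : Fin N) : A.side X j = -1 ∨ A.side X j = 1 := by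
  unfold side
  split_ifs with h
  · exact Real.sign_apply_eq_of_ne_zero _ (A.l_edge_self X ⟨j, h⟩)
  · exact Real.sign_apply_eq_of_ne_zero _ (A.f_point_ne X h)

lemma side_mul_l_edge_pos (X : A.Vertex) (j : {j // j ∈ X.1}) :
    0 < A.side X j * A.l j (A.edge X j) := by
  rw [side, dif_pos j.2]
  exact Real.sign_mul_pos_of_ne_zero _ (A.l_edge_self X j)

lemma side_mul_f_point_pos (X : A.Vertex) {j : Fin N} (hj : j ∉ X.1) :
    0 < A.side X j * A.f j (A.point X) := by
  rw [side, dif_neg hj]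
  exact Real.sign_mul_pos_of_ne_zero _ (A.f_point_ne X hj)

lemma domainAt_eq_chamber (X : A.Vertex) : A.domainAt X = A.chamber (A.side X) := by
  rw [A.isDomainAt_signs X (A.domainAt_spec X)]
  ext y
  refine ⟨fun h j => ?_, fun h => ⟨fun j => ?_, fun j hj => ?_⟩⟩
  · by_cases hj : j ∈ X.1
    · exact (mul_pos_iff_mul_pos (A.side_mul_l_edge_pos X ⟨j, hj⟩) _).2 (h.1 ⟨j, hj⟩)
    · exact (mul_pos_iff_mul_pos (A.side_mul_f_point_pos X hj) _).2 (h.2 j hj)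
  · exact (mul_pos_iff_mul_pos (A.side_mul_l_edge_pos X j) _).1 (h j)
  · exact (mul_pos_iff_mul_pos (A.side_mul_f_point_pos X hj) _).1 (h j)

lemma chamber_side_nonempty (X : A.Vertex) : (A.chamber (A.side X)).Nonempty := by
  obtain ⟨⟨x, hx, h⟩, -⟩ := A.domainAt_spec X
  exact ⟨x, A.domainAt_eq_chamber X ▸ h ▸ mem_connectedComponentIn hx⟩

lemma mem_cone_iff (X : A.Vertex) (x : Fin k → ℝ) :
    x ∈ A.cone X ↔ ∀ j ∈ X.1, 0 < A.side X j * A.f j x := by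
  constructor
  · rintro ⟨a, ha, rfl⟩ j hj
    rw [A.f_add, A.f_point X hj, zero_add, A.l_sum_edge X a ⟨j, hj⟩, mul_left_comm]
    exact mul_pos (ha _) (A.side_mul_l_edge_pos X ⟨j, hj⟩)
  · intro h
    refine ⟨fun j => A.l j (x - A.point X) / A.l j (A.edge X j), fun j => ?_, ?_⟩
    · beta_reduce
      rw [A.l_sub_point X j.2, div_pos_iff, ← mul_pos_iff, mul_comm]
      exact (mul_pos_iff_mul_pos (A.side_mul_l_edge_pos X j) _).1 (h j j.2)
    · rw [← A.eq_sum_edge X (x - A.point X), add_sub_cancel]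

lemma isOpen_cone (X : A.Vertex) : IsOpen (A.cone X) := by
  have : A.cone X = ⋂ j ∈ X.1, {x | 0 < A.side X j * A.f j x} := by
    ext x
    simp only [A.mem_cone_iff, mem_iInter, mem_ofPred_eq]
  rw [this]
  exact isOpen_biInter_finset fun j _ =>
    isOpen_lt continuous_const (continuous_const.mul (A.continuous_f j))

lemma add_smul_mem_cone (X : A.Vertex) {x : Fin k → ℝ} {r : ℝ} (hr : 0 < r) :
    A.point X + r • (x - A.point X) ∈ A.cone X ↔ x ∈ A.cone X := by
  simp only [A.mem_cone_iff]
  refine forall₂_congr fun j hj => ?_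
  rw [A.f_add, A.f_point X hj, zero_add, map_smul, A.l_sub_point X hj, smul_eq_mul,
    mul_left_comm, mul_pos_iff_of_pos_left hr]

lemma mem_separating_chamber {s s' : Fin N → ℝ} (hs : (A.chamber s).Nonempty)
    (hs' : (A.chamber s').Nonempty) (j : Fin N) :
    j ∈ A.separating (A.chamber s) (A.chamber s') ↔ s j * s' j < 0 := by
  obtain ⟨x, hx⟩ := hs
  obtain ⟨y, hy⟩ := hs'
  simp only [separating, Finset.mem_filter, Finset.mem_univ, true_and]
  exact ⟨fun h => (mul_neg_iff_mul_neg (hx j) (hy j)).2 (h x hx y hy),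
    fun h z hz w hw => (mul_neg_iff_mul_neg (hz j) (hw j)).1 h⟩

lemma mul_side_pos {s : Fin N → ℝ} (hs : ∀ j, s j ≠ 0) {X : A.Vertex}
    (hX : A.point X ∈ A.polyhedron s) {j : Fin N} (hj : j ∉ X.1) : 0 < s j * A.side X j := by
  rw [mul_comm, mul_pos_iff_mul_pos (A.side_mul_f_point_pos X hj), mul_comm]
  exact A.mul_f_point_pos hs hX hj

lemma psi_eq (Δ : Set (Fin k → ℝ)) (X : A.Vertex) :
    A.psi Δ X = (-1) ^ (A.separating Δ (A.domainAt X)).card *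
      Complex.exp (Complex.I * Real.pi * A.weight (A.separating Δ (A.domainAt X))) := by
  rw [psi]
  split_ifs with h
  · have hsep : A.separating Δ (A.domainAt X) = ∅ := by
      refine Finset.eq_empty_of_forall_notMem fun j => ?_
      rw [h, A.domainAt_eq_chamber,
        A.mem_separating_chamber (A.chamber_side_nonempty X) (A.chamber_side_nonempty X)]
      exact (mul_self_nonneg _).not_gt
    simp [hsep, weight]
  · rfl

/-! ### The signed count of vertices -/

/-- The face of the polyhedron cut out by the hyperplanes with indices in `T`. -/
def face (s : Fin N → ℝ) (T : Finset (Fin N)) : Set (Fin k → ℝ) :=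
  {x ∈ A.polyhedron s | ∀ j ∈ T, A.f j x = 0}

/-- The linear forms that are nonconstant on every intersection line of `k - 1` hyperplanes. -/
def IsGeneric (g : (Fin k → ℝ) →ₗ[ℝ] ℝ) : Prop := ∀ X j, g (A.edge X j) ≠ 0

/-- The vector directing the edge at `X` transverse to `H j`, normalized so that it points into
the half-space `{0 ≤ s j * f j}` with unit speed. -/
noncomputable def inwardEdge (s : Fin N → ℝ) (X : A.Vertex) (j : {j // j ∈ X.1}) : Fin k → ℝ :=
  (s j * A.l j (A.edge X j))⁻¹ • A.edge X j

open Classical in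
/-- The edges at `X` along which `g` decreases when one moves into the half-spaces of `s`. -/
noncomputable def descending (s : Fin N → ℝ) (g : (Fin k → ℝ) →ₗ[ℝ] ℝ) (X : A.Vertex) :
    Finset (Fin N) :=
  {j | ∃ h : j ∈ X.1, g (A.inwardEdge s X ⟨j, h⟩) < 0}

/-- The hyperplanes through `x`. -/
noncomputable def activeSet (x : Fin k → ℝ) : Finset (Fin N) := {j | A.f j x = 0}

variable {A}

lemma mem_activeSet {x : Fin k → ℝ} {j : Fin N} : j ∈ A.activeSet x ↔ A.f j x = 0 := by
  simp [activeSet]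

lemma point_injective : Function.Injective A.point := by
  refine fun X Y h => Subtype.ext (Finset.eq_of_subset_of_card_le (fun j hj => ?_) ?_)
  · exact of_not_not fun hjY => A.f_point_ne Y hjY (h ▸ A.f_point X hj)
  · rw [X.2, Y.2]

lemma isGeneric_f0 : A.IsGeneric A.f0 := fun X j => by simp [A.f0_edge]

lemma coe_mem_descending {s : Fin N → ℝ} {g : (Fin k → ℝ) →ₗ[ℝ] ℝ} {X : A.Vertex}
    {j : {j // j ∈ X.1}} : j.1 ∈ A.descending s g X ↔ g (A.inwardEdge s X j) < 0 := by
  simp [descending]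

lemma descending_subset (s : Fin N → ℝ) (g : (Fin k → ℝ) →ₗ[ℝ] ℝ) (X : A.Vertex) :
    A.descending s g X ⊆ X.1 := fun j hj => by
  obtain ⟨hjX, -⟩ := (Finset.mem_filter.1 hj).2
  exact hjX

lemma point_mem_face_iff {s : Fin N → ℝ} {T : Finset (Fin N)} {X : A.Vertex} :
    A.point X ∈ A.face s T ↔ A.point X ∈ A.polyhedron s ∧ T ⊆ X.1 :=
  and_congr_right fun _ => forall₂_congr fun _ _ =>
    ⟨fun h => of_not_not fun hj => A.f_point_ne X hj h, A.f_point X⟩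

lemma l_inwardEdge (s : Fin N → ℝ) (X : A.Vertex) (j : {j // j ∈ X.1}) {i : Fin N} (hi : i ∈ X.1)
    (hij : i ≠ j) : A.l i (A.inwardEdge s X j) = 0 := by
  rw [inwardEdge, map_smul, A.l_edge X j hi hij, smul_zero]

section Signs

variable {s : Fin N → ℝ} (hs : ∀ j, s j ≠ 0)
include hs

lemma mul_l_inwardEdge_self (X : A.Vertex) (j : {j // j ∈ X.1}) :
    s j * A.l j (A.inwardEdge s X j) = 1 := by
  rw [inwardEdge, map_smul, smul_eq_mul, mul_left_comm,
    inv_mul_cancel₀ (mul_ne_zero (hs j) (A.l_edge_self X j))]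

lemma IsGeneric.map_inwardEdge_ne_zero {g : (Fin k → ℝ) →ₗ[ℝ] ℝ} (hg : A.IsGeneric g)
    (X : A.Vertex) (j : {j // j ∈ X.1}) : g (A.inwardEdge s X j) ≠ 0 := by
  rw [inwardEdge, map_smul, smul_eq_mul]
  exact mul_ne_zero (inv_ne_zero (mul_ne_zero (hs j) (A.l_edge_self X j))) (hg X j)

lemma map_sub_map_point (g : (Fin k → ℝ) →ₗ[ℝ] ℝ) (X : A.Vertex) (x : Fin k → ℝ) :
    g x - g (A.point X) = ∑ j : {j // j ∈ X.1}, s j * A.f j x * g (A.inwardEdge s X j) := by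
  rw [← map_sub, A.eq_sum_edge X (x - A.point X), map_sum]
  refine Finset.sum_congr rfl fun j _ => ?_
  have := A.l_edge_self X j
  have := hs j
  rw [A.l_sub_point X j.2, inwardEdge, map_smul, map_smul, smul_eq_mul, smul_eq_mul]
  field_simp

lemma exists_point_add_smul_inwardEdge_mem_face {T : Finset (Fin N)} {X : A.Vertex}
    (hX : A.point X ∈ A.face s T) (j : {j // j ∈ X.1}) (hj : j.1 ∉ T) :
    ∃ ε : ℝ, 0 < ε ∧ A.point X + ε • A.inwardEdge s X j ∈ A.face s T := by
  obtain ⟨ε, hε, -, hsmall⟩ := A.exists_small X (A.inwardEdge s X j) 1 one_pos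
  have hf : ∀ i ∈ X.1, A.f i (A.point X + ε • A.inwardEdge s X j) =
      ε * A.l i (A.inwardEdge s X j) := fun i hi => by
    rw [A.f_add, A.f_point X hi, zero_add, map_smul, smul_eq_mul]
  refine ⟨ε, hε, fun i => ?_, fun i hi => ?_⟩
  · by_cases hi : i ∈ X.1
    · rw [hf i hi]
      by_cases hij : i = j
      · rw [hij, mul_left_comm, mul_l_inwardEdge_self hs, mul_one]
        exact hε.le
      · rw [l_inwardEdge s X j hi hij, mul_zero, mul_zero]
    · have hpos := A.mul_f_point_pos hs hX.1 hi
      rw [mul_comm] at hpos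
      exact ((mul_pos_iff_mul_pos hpos _).1 (hsmall i hi)).le
  · have hiX := (point_mem_face_iff.1 hX).2 hi
    rw [hf i hiX, l_inwardEdge s X j hiX (fun h => hj (h ▸ hi)), mul_zero]

end Signs

lemma card_activeSet_le (x : Fin k → ℝ) : (A.activeSet x).card ≤ k := by
  by_contra! h
  obtain ⟨Y, hY, hYcard⟩ := Finset.exists_subset_card_eq (Nat.succ_le_of_lt h)
  exact A.inter_succ Y hYcard ⟨x, fun j hj => mem_activeSet.1 (hY hj)⟩

lemma IsGeneric.exists_descent_direction {g : (Fin k → ℝ) →ₗ[ℝ] ℝ} (hg : A.IsGeneric g)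
    {U : Finset (Fin N)} (hU : U.card < k) : ∃ v, (∀ j ∈ U, A.l j v = 0) ∧ g v < 0 := by
  obtain ⟨X, hUX⟩ := A.exists_vertex_superset hU.le
  obtain ⟨j, hjX, hjU⟩ := Finset.exists_mem_notMem_of_card_lt_card (hU.trans_eq X.2.symm)
  have hl : ∀ i ∈ U, A.l i (A.edge X ⟨j, hjX⟩) = 0 := fun i hi =>
    A.l_edge X ⟨j, hjX⟩ (hUX hi) (ne_of_mem_of_not_mem hi hjU)
  rcases (hg X ⟨j, hjX⟩).lt_or_gt with hneg | hpos
  · exact ⟨_, hl, hneg⟩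
  · exact ⟨-A.edge X ⟨j, hjX⟩, fun i hi => by rw [map_neg, hl i hi, neg_zero],
      by rwa [map_neg, neg_lt_zero]⟩

lemma exists_mul_l_neg {s : Fin N → ℝ} {g : (Fin k → ℝ) →ₗ[ℝ] ℝ}
    (hb : BddBelow (g '' A.polyhedron s)) {x v : Fin k → ℝ} (hx : x ∈ A.polyhedron s)
    (hv : g v < 0) : ∃ j, s j * A.l j v < 0 := by
  by_contra! hnn
  obtain ⟨m, hm⟩ := hb
  have hray : ∀ t : ℝ, 0 ≤ t → m ≤ g x + t * g v := fun t ht => by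
    have hmem : x + t • v ∈ A.polyhedron s := fun j => by
      rw [A.f_add, map_smul, smul_eq_mul, mul_add, mul_left_comm]
      exact add_nonneg (hx j) (mul_nonneg ht (hnn j))
    simpa using hm (mem_image_of_mem g hmem)
  have hlim : Tendsto (fun t : ℝ => g x + t * g v) atTop atBot :=
    tendsto_atBot_add_const_left _ _ (tendsto_id.atTop_mul_const_of_neg hv)
  obtain ⟨t, ht, htm⟩ := ((eventually_ge_atTop 0).and (hlim.eventually_lt_atBot m)).exists
  exact (hray t ht).not_gt htm

lemma exists_add_smul_mem_polyhedron {s : Fin N → ℝ} {x v : Fin k → ℝ}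
    (hx : x ∈ A.polyhedron s) (hv : ∃ j, s j * A.l j v < 0) :
    ∃ t : ℝ, 0 ≤ t ∧ x + t • v ∈ A.polyhedron s ∧ ∃ j, A.l j v ≠ 0 ∧ A.f j (x + t • v) = 0 := by
  have hf : ∀ t j, s j * A.f j (x + t • v) = s j * A.f j x + t * (s j * A.l j v) := fun t j => by
    rw [A.f_add, map_smul, smul_eq_mul]
    ring
  obtain ⟨i, hi, hmin⟩ := ({j | s j * A.l j v < 0} : Finset (Fin N)).exists_min_image
    (fun j => s j * A.f j x / -(s j * A.l j v)) (by simpa [Finset.Nonempty] using hv)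
  simp only [Finset.mem_filter, Finset.mem_univ, true_and] at hi hmin
  set t := s i * A.f i x / -(s i * A.l i v) with ht
  have ht0 : 0 ≤ t := div_nonneg (hx i) (neg_nonneg.2 hi.le)
  refine ⟨t, ht0, fun j => ?_, i, right_ne_zero_of_mul hi.ne, ?_⟩
  · rw [hf]
    rcases lt_or_ge (s j * A.l j v) 0 with hj | hj
    · have := (le_div_iff₀ (neg_pos.2 hj)).1 (hmin j hj)
      linarith
    · exact add_nonneg (hx j) (mul_nonneg ht0 hj)
  · refine (mul_eq_zero_iff_left (left_ne_zero_of_mul hi.ne)).1 ?_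
    rw [hf, ht, div_neg, neg_mul, div_mul_cancel₀ _ hi.ne, add_neg_cancel]

lemma exists_point_mem_face_le {s : Fin N → ℝ} {g : (Fin k → ℝ) →ₗ[ℝ] ℝ} (hg : A.IsGeneric g)
    (hb : BddBelow (g '' A.polyhedron s)) {T : Finset (Fin N)} {x : Fin k → ℝ}
    (hx : x ∈ A.face s T) : ∃ X, A.point X ∈ A.face s T ∧ g (A.point X) ≤ g x := by
  induction hn : k - (A.activeSet x).card using Nat.strong_induction_on generalizing x with
  | _ n ih =>
  rcases (card_activeSet_le x).eq_or_lt with hcard | hcard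
  · have hpt := A.eq_point ⟨_, hcard⟩ fun j hj => mem_activeSet.1 hj
    exact ⟨_, hpt ▸ hx, by rw [← hpt]⟩
  · obtain ⟨v, hlv, hgv⟩ := hg.exists_descent_direction hcard
    obtain ⟨t, ht, hxt, i, hiv, hi⟩ :=
      exists_add_smul_mem_polyhedron hx.1 (exists_mul_l_neg hb hx.1 hgv)
    have hactive : ∀ j ∈ A.activeSet x, A.f j (x + t • v) = 0 := fun j hj => by
      rw [A.f_add, map_smul, hlv j hj, mem_activeSet.1 hj, smul_zero, add_zero]
    have hlt : (A.activeSet x).card < (A.activeSet (x + t • v)).card :=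
      Finset.card_lt_card ((Finset.ssubset_iff_of_subset
        fun j hj => mem_activeSet.2 (hactive j hj)).2
          ⟨i, mem_activeSet.2 hi, fun h => hiv (hlv i h)⟩)
    have hface : x + t • v ∈ A.face s T :=
      ⟨hxt, fun j hj => hactive j (mem_activeSet.2 (hx.2 j hj))⟩
    obtain ⟨X, hX, hle⟩ := ih _ (by omega) hface rfl
    refine ⟨X, hX, hle.trans ?_⟩
    rw [map_add, map_smul, smul_eq_mul, add_le_iff_nonpos_right]
    exact mul_nonpos_of_nonneg_of_nonpos ht hgv.le

section Optimum

variable {s : Fin N → ℝ} (hs : ∀ j, s j ≠ 0) {g : (Fin k → ℝ) →ₗ[ℝ] ℝ} (hg : A.IsGeneric g)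
include hs hg

lemma map_inwardEdge_pos {X : A.Vertex} {j : {j // j ∈ X.1}} (hj : j.1 ∉ A.descending s g X) :
    0 < g (A.inwardEdge s X j) :=
  (not_lt.1 (coe_mem_descending.not.1 hj)).lt_of_ne' (hg.map_inwardEdge_ne_zero hs X j)

lemma map_point_lt_of_descending_subset {T : Finset (Fin N)} {X : A.Vertex}
    (hX : A.descending s g X ⊆ T) {x : Fin k → ℝ} (hx : x ∈ A.face s T) (hne : x ≠ A.point X) :
    g (A.point X) < g x := by
  have hpos : ∀ j : {j // j ∈ X.1}, j.1 ∉ T → 0 < g (A.inwardEdge s X j) := fun j hj =>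
    map_inwardEdge_pos hs hg fun h => hj (hX h)
  rw [← sub_pos, map_sub_map_point hs]
  refine Finset.sum_pos' (fun j _ => ?_) ?_
  · by_cases hj : j.1 ∈ T
    · rw [hx.2 j hj, mul_zero, zero_mul]
    · exact mul_nonneg (hx.1 j) (hpos j hj).le
  · obtain ⟨j, hjX, hj⟩ : ∃ j ∈ X.1, A.f j x ≠ 0 := by
      by_contra! h
      exact hne (A.eq_point X h)
    exact ⟨⟨j, hjX⟩, Finset.mem_univ _,
      mul_pos ((hx.1 j).lt_of_ne' (mul_ne_zero (hs j) hj)) (hpos ⟨j, hjX⟩ fun h => hj (hx.2 j h))⟩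

lemma existsUnique_descending_subset (hb : BddBelow (g '' A.polyhedron s))
    {T : Finset (Fin N)} (hT : (A.face s T).Nonempty) :
    ∃! X, A.point X ∈ A.face s T ∧ A.descending s g X ⊆ T := by
  classical
  obtain ⟨x, hx⟩ := hT
  obtain ⟨X₀, hX₀, -⟩ := exists_point_mem_face_le hg hb hx
  obtain ⟨X, hX, hmin⟩ := ({X | A.point X ∈ A.face s T} : Finset A.Vertex).exists_min_image
    (fun X => g (A.point X)) ⟨X₀, by simpa using hX₀⟩
  simp only [Finset.mem_filter, Finset.mem_univ, true_and] at hX hmin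
  refine ⟨X, ⟨hX, fun j hj => ?_⟩, fun Y hY => ?_⟩
  · by_contra hjT
    have hjX := descending_subset s g X hj
    obtain ⟨ε, hε, hface⟩ := exists_point_add_smul_inwardEdge_mem_face hs hX ⟨j, hjX⟩ hjT
    obtain ⟨Y, hY, hle⟩ := exists_point_mem_face_le hg hb hface
    have hneg : g (A.inwardEdge s X ⟨j, hjX⟩) < 0 := coe_mem_descending.1 hj
    have hge := (hmin Y hY).trans hle
    rw [map_add, map_smul, smul_eq_mul, le_add_iff_nonneg_right] at hge
    exact hge.not_gt (mul_neg_of_pos_of_neg hε hneg)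
  · by_contra hne
    exact (hmin Y hY.1).not_gt
      (map_point_lt_of_descending_subset hs hg hY.2 hX (point_injective.ne fun h => hne h.symm))

open Classical in
lemma sum_neg_one_pow_descending (hb : BddBelow (g '' A.polyhedron s)) (S : Finset (Fin N)) :
    ∑ X : A.Vertex with A.point X ∈ A.polyhedron s ∧ A.descending s g X = X.1 ∩ S,
      (-1 : ℤ) ^ (X.1 ∩ S).card =
    ∑ T ∈ S.powerset with (A.face s T).Nonempty, (-1 : ℤ) ^ T.card := by
  calc
    _ = ∑ X : A.Vertex with A.point X ∈ A.polyhedron s,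
          ∑ T ∈ Finset.Icc (A.descending s g X) (X.1 ∩ S), (-1 : ℤ) ^ T.card := by
      simp only [sum_Icc_neg_one_pow_card, Finset.filter_and, ← Finset.sum_filter,
        Finset.filter_filter]
    _ = ∑ T ∈ S.powerset with (A.face s T).Nonempty,
          ∑ X : A.Vertex with A.point X ∈ A.face s T ∧ A.descending s g X ⊆ T,
            (-1 : ℤ) ^ T.card := by
      refine Finset.sum_comm' fun X T => ?_
      simp only [Finset.mem_filter, Finset.mem_univ, true_and, Finset.mem_Icc,
        Finset.mem_powerset, point_mem_face_iff, Finset.subset_inter_iff]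
      constructor
      · rintro ⟨hX, hT, hTX, hTS⟩
        exact ⟨⟨⟨hX, hTX⟩, hT⟩, hTS, _, point_mem_face_iff.2 ⟨hX, hTX⟩⟩
      · rintro ⟨⟨⟨hX, hTX⟩, hT⟩, hTS, -⟩
        exact ⟨hX, hT, hTX, hTS⟩
    _ = _ := by
      refine Finset.sum_congr rfl fun T hT => ?_
      rw [Finset.sum_const, (Fintype.existsUnique_iff_card_one _).1
        (existsUnique_descending_subset hs hg hb (Finset.mem_filter.1 hT).2), one_smul]

end Optimum

variable (A) in
/-- The hyperplanes that strictly separate `x` from the chamber of `s`. -/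
noncomputable def violated (s : Fin N → ℝ) (x : Fin k → ℝ) : Finset (Fin N) :=
  {j | s j * A.f j x < 0}

lemma mem_violated {s : Fin N → ℝ} {x : Fin k → ℝ} {j : Fin N} :
    j ∈ A.violated s x ↔ s j * A.f j x < 0 := by
  simp [violated]

lemma violated_eq_empty_iff {s : Fin N → ℝ} (hs : ∀ j, s j ≠ 0) {x : Fin k → ℝ}
    (hx : x ∈ A.compl) : A.violated s x = ∅ ↔ x ∈ A.chamber s := by
  simp only [Finset.eq_empty_iff_forall_notMem, mem_violated, not_lt]
  exact forall_congr' fun j => (mul_ne_zero (hs j) (hx j)).symm.le_iff_lt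

lemma f0_inwardEdge_neg_iff (s : Fin N → ℝ) (X : A.Vertex) (j : {j // j ∈ X.1}) :
    A.f0 (A.inwardEdge s X j) < 0 ↔ s j * A.l j (A.edge X j) < 0 := by
  rw [inwardEdge, map_smul, A.f0_edge, smul_eq_mul, mul_one, inv_lt_zero]

lemma IsGeneric.exists_isGeneric_forall_lt {g : (Fin k → ℝ) →ₗ[ℝ] ℝ} (hg : A.IsGeneric g)
    {s : Fin N → ℝ} (hb : BddBelow (g '' A.polyhedron s)) {x : Fin k → ℝ}
    (hx : (A.violated s x).Nonempty) :
    ∃ g', A.IsGeneric g' ∧ BddBelow (g' '' A.polyhedron s) ∧ ∀ y ∈ A.polyhedron s, g' x < g' y := by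
  obtain ⟨i, hi⟩ := hx
  rw [mem_violated] at hi
  obtain ⟨m, hm⟩ := hb
  have hgen : ∀ᶠ η : ℝ in 𝓝[>] 0, ∀ X j, s i * A.l i (A.edge X j) + η * g (A.edge X j) ≠ 0 := by
    refine eventually_all.2 fun X => eventually_all.2 fun j => ?_
    filter_upwards [((nhdsGT_le_nhdsNE 0).trans (nhdsNE_le_cofinite 0)) (finite_singleton
      (-(s i * A.l i (A.edge X j)) / g (A.edge X j))).compl_mem_cofinite] with η hη h
    exact hη ((eq_div_iff (hg X j)).2 (eq_neg_of_add_eq_zero_right h))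
  have hsep : ∀ᶠ η : ℝ in 𝓝[>] 0, s i * A.f i x < η * (m - g x) := by
    have hcont : Continuous fun η : ℝ => η * (m - g x) := by fun_prop
    exact nhdsWithin_le_nhds (hcont.continuousAt.eventually (lt_mem_nhds (by simpa using hi)))
  obtain ⟨η, ⟨hgen, hsep⟩, hη : 0 < η⟩ := ((hgen.and hsep).and self_mem_nhdsWithin).exists
  have hgap : ∀ y, (s i • A.l i + η • g) y - (s i • A.l i + η • g) x =
      s i * A.f i y - s i * A.f i x + η * (g y - g x) := fun y => by
    rw [← map_sub, LinearMap.add_apply, LinearMap.smul_apply, LinearMap.smul_apply, A.l_sub,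
      map_sub, smul_eq_mul, smul_eq_mul, mul_sub]
  have hlt : ∀ y ∈ A.polyhedron s, (s i • A.l i + η • g) x < (s i • A.l i + η • g) y :=
    fun y hy => by
      have hmy := mul_le_mul_of_nonneg_left
        (sub_le_sub_right (hm (mem_image_of_mem g hy)) (g x)) hη.le
      rw [← sub_pos, hgap]
      linarith [hy i]
  exact ⟨_, fun X j => by simpa using hgen X j, ⟨_, forall_mem_image.2 fun y hy => (hlt y hy).le⟩,
    hlt⟩

section Signs

variable {s : Fin N → ℝ} (hs : ∀ j, s j ≠ 0)
include hs

lemma map_point_lt_of_descending_eq_inter_violated {g : (Fin k → ℝ) →ₗ[ℝ] ℝ}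
    (hg : A.IsGeneric g) {x : Fin k → ℝ} (hx : x ∈ A.compl) {X : A.Vertex}
    (hX : A.descending s g X = X.1 ∩ A.violated s x) : g (A.point X) < g x := by
  have := A.nonempty_indices X
  rw [← sub_pos, map_sub_map_point hs]
  refine Finset.sum_pos (fun j _ => ?_) Finset.univ_nonempty
  have hiff : g (A.inwardEdge s X j) < 0 ↔ s j * A.f j x < 0 := by
    rw [← coe_mem_descending, hX, Finset.mem_inter, and_iff_right j.2, mem_violated]
  rw [mul_pos_iff_neg_iff_neg one_ne_zero (mul_ne_zero (hs j) (hx j))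
    (hg.map_inwardEdge_ne_zero hs X j), one_mul, one_mul, hiff]

open Classical in
/- The left side does not depend on `g`: it counts faces. For `x` outside the chamber, a form `g`
whose value at `x` is below its minimum over the polyhedron leaves no term on the left. -/
lemma sum_neg_one_pow_descending_violated {g : (Fin k → ℝ) →ₗ[ℝ] ℝ} (hg : A.IsGeneric g)
    (hb : BddBelow (g '' A.polyhedron s)) {x : Fin k → ℝ} (hx : x ∈ A.compl) :
    ∑ X : A.Vertex with A.point X ∈ A.polyhedron s ∧
        A.descending s g X = X.1 ∩ A.violated s x, (-1 : ℤ) ^ (X.1 ∩ A.violated s x).card =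
      if x ∈ A.chamber s then 1 else 0 := by
  rw [sum_neg_one_pow_descending hs hg hb]
  split_ifs with hxs
  · have hface : (A.face s ∅).Nonempty := ⟨x, fun j => (hxs j).le, by simp⟩
    simp [(violated_eq_empty_iff hs hx).2 hxs, Finset.filter_singleton, hface]
  · obtain ⟨g', hg', hb', hlt⟩ := hg.exists_isGeneric_forall_lt hb
      (Finset.nonempty_iff_ne_empty.2 (mt (violated_eq_empty_iff hs hx).1 hxs))
    rw [← sum_neg_one_pow_descending hs hg' hb']
    refine Finset.sum_eq_zero fun X hX => ?_
    obtain ⟨hpoly, hdesc⟩ := (Finset.mem_filter.1 hX).2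
    exact ((hlt _ hpoly).asymm (map_point_lt_of_descending_eq_inter_violated hs hg' hx hdesc)).elim

lemma separating_chamber_domainAt (hne : (A.chamber s).Nonempty) {X : A.Vertex}
    (hX : A.point X ∈ A.polyhedron s) :
    A.separating (A.chamber s) (A.domainAt X) = A.descending s A.f0 X := by
  ext j
  rw [A.domainAt_eq_chamber, A.mem_separating_chamber hne (A.chamber_side_nonempty X)]
  by_cases hj : j ∈ X.1
  · rw [coe_mem_descending (j := ⟨j, hj⟩), f0_inwardEdge_neg_iff]
    exact mul_neg_iff_mul_neg (mul_self_pos.2 (hs j)) (A.side_mul_l_edge_pos X ⟨j, hj⟩)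
  · exact iff_of_false (A.mul_side_pos hs hX hj).not_gt fun h => hj (descending_subset s _ X h)

lemma mem_cone_iff_descending (X : A.Vertex) {x : Fin k → ℝ} (hx : x ∈ A.compl) :
    x ∈ A.cone X ↔ A.descending s A.f0 X = X.1 ∩ A.violated s x := by
  have hdesc : A.descending s A.f0 X = X.1 ∩ A.violated s x ↔
      ∀ j : {j // j ∈ X.1}, j.1 ∈ A.descending s A.f0 X ↔ j.1 ∈ A.violated s x := by
    rw [← Finset.inter_eq_right.2 (descending_subset s A.f0 X)]
    simp [Finset.ext_iff]
  rw [hdesc, A.mem_cone_iff, Subtype.forall]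
  refine forall₂_congr fun j hj => ?_
  rw [coe_mem_descending (j := ⟨j, hj⟩), f0_inwardEdge_neg_iff, mem_violated,
    ← mul_pos_iff_neg_iff_neg (hs j) (A.l_edge_self X ⟨j, hj⟩) (hx j)]
  exact mul_pos_iff_mul_pos (A.side_mul_l_edge_pos X ⟨j, hj⟩) _

open Classical in
lemma sum_indicator_cone (hne : (A.chamber s).Nonempty) (hb : BddBelow (A.f0 '' A.chamber s))
    {x : Fin k → ℝ} (hx : x ∈ A.compl) :
    ∑ X ∈ A.boundaryVertices (A.chamber s) with x ∈ A.cone X,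
        (-1 : ℤ) ^ (A.separating (A.chamber s) (A.domainAt X)).card =
      if x ∈ A.chamber s then 1 else 0 := by
  have hb' : BddBelow (A.f0 '' A.polyhedron s) := by
    rw [← A.closure_chamber hne]
    exact hb.closure.mono (image_closure_subset_closure_image A.f0.continuous_of_finiteDimensional)
  rw [← sum_neg_one_pow_descending_violated hs isGeneric_f0 hb' hx]
  refine Finset.sum_congr (Finset.ext fun X => ?_) fun X hX => ?_
  · simp only [Finset.mem_filter, Finset.mem_univ, true_and, A.mem_boundaryVertices_chamber hne,
      mem_cone_iff_descending hs X hx]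
  · obtain ⟨hpoly, hdesc⟩ := (Finset.mem_filter.1 hX).2
    rw [separating_chamber_domainAt hs hne hpoly, hdesc]

end Signs

/-! ### Analytic continuation along the rotations of a cone -/

lemma rotate_ofReal (X : A.Vertex) (r : ℝ) (x : Fin k → ℝ) :
    A.rotate X r x = incl (A.point X + r • (x - A.point X)) := by
  ext i
  simp [rotate, incl]

lemma rotate_ofReal_mul (X : A.Vertex) (r : ℝ) (t : ℂ) (x : Fin k → ℝ) :
    A.rotate X (r * t) x = A.rotate X t (A.point X + r • (x - A.point X)) := by
  ext i
  simp [rotate, incl, mul_left_comm, mul_assoc]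

lemma analyticAt_rotate (X : A.Vertex) (x : Fin k → ℝ) (t : ℂ) :
    AnalyticAt ℂ (fun t => A.rotate X t x) t :=
  analyticAt_const.add (analyticAt_id.smul analyticAt_const)

lemma rotate_mem_rotatedCone {X : A.Vertex} {x : Fin k → ℝ} (hx : x ∈ A.cone X) {w : ℂ}
    (hw : w ≠ 0) : A.rotate X w x ∈ A.rotatedCone X ((‖w‖⁻¹ : ℝ) * w) := by
  have hnorm : 0 < ‖w‖ := norm_pos_iff.2 hw
  refine ⟨_, (A.add_smul_mem_cone X hnorm).2 hx, ?_⟩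
  rw [← rotate_ofReal_mul, ← mul_assoc, ← Complex.ofReal_mul, mul_inv_cancel₀ hnorm.ne',
    Complex.ofReal_one, one_mul]

lemma exists_add_smul_mem_domainAt {X : A.Vertex} {x : Fin k → ℝ} (hx : x ∈ A.cone X) :
    ∃ ε : ℝ, A.point X + ε • (x - A.point X) ∈ A.domainAt X := by
  obtain ⟨ε, hε, -, hsmall⟩ := A.exists_small X (x - A.point X) 1 one_pos
  rw [A.domainAt_eq_chamber]
  refine ⟨ε, fun j => ?_⟩
  by_cases hj : j ∈ X.1
  · exact (A.mem_cone_iff X _).1 ((A.add_smul_mem_cone X hε).2 hx) j hj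
  · exact (mul_pos_iff_mul_pos (A.side_mul_f_point_pos X hj) _).2 (hsmall j hj)

variable (A) in
/-- The determination of `∏ j, |f j| ^ α j` given by the principal powers of the forms
`± f j` that are positive on `Δ_X`. -/
noncomputable def principalBranch (X : A.Vertex) (z : Fin k → ℂ) : ℂ :=
  ∏ j, ((A.side X j : ℂ) * A.fC j z) ^ (A.α j : ℂ)

lemma side_mul_fC_incl_mem_slitPlane {X : A.Vertex} {x : Fin k → ℝ} (hx : x ∈ A.domainAt X)
    (j : Fin N) : (A.side X j : ℂ) * A.fC j (incl x) ∈ Complex.slitPlane := by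
  rw [A.fC_incl, ← Complex.ofReal_mul, Complex.ofReal_mem_slitPlane]
  rw [A.domainAt_eq_chamber] at hx
  exact hx j

lemma side_mul_fC_rotate_mem_slitPlane {X : A.Vertex} {x : Fin k → ℝ} (hx : x ∈ A.cone X) {t : ℂ}
    (ht : t.im ≠ 0) (j : Fin N) :
    (A.side X j : ℂ) * A.fC j (A.rotate X t x) ∈ Complex.slitPlane := by
  rw [A.fC_rotate]
  by_cases hl : A.l j (x - A.point X) = 0
  · have hj : j ∉ X.1 := fun hj => by
      have hpos := (A.mem_cone_iff X x).1 hx j hj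
      rw [← A.l_sub_point X hj, hl, mul_zero] at hpos
      exact hpos.false
    rw [hl, Complex.ofReal_zero, mul_zero, add_zero, ← Complex.ofReal_mul,
      Complex.ofReal_mem_slitPlane]
    exact A.side_mul_f_point_pos X hj
  · have hside : A.side X j ≠ 0 := by rcases A.side_eq_or X j with h | h <;> simp [h]
    refine Complex.mem_slitPlane_iff.2 (Or.inr ?_)
    simp [hside, ht, hl, -map_sub]

lemma abs_side (X : A.Vertex) (j : Fin N) : |A.side X j| = 1 := by
  rcases A.side_eq_or X j with h | h <;> simp [h]

lemma principalBranch_incl {X : A.Vertex} {x : Fin k → ℝ} (hx : x ∈ A.domainAt X) :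
    A.principalBranch X (incl x) = ((∏ j, |A.f j x| ^ A.α j : ℝ) : ℂ) := by
  rw [A.domainAt_eq_chamber] at hx
  rw [principalBranch, Complex.ofReal_prod]
  refine Finset.prod_congr rfl fun j _ => ?_
  have habs : A.side X j * A.f j x = |A.f j x| := by
    rw [← abs_of_pos (hx j), abs_mul, abs_side, one_mul]
  rw [A.fC_incl, ← Complex.ofReal_mul, habs, Complex.ofReal_cpow (abs_nonneg _)]

lemma analyticAt_principalBranch {X : A.Vertex} {z : Fin k → ℂ}
    (hz : ∀ j, (A.side X j : ℂ) * A.fC j z ∈ Complex.slitPlane) :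
    AnalyticAt ℂ (A.principalBranch X) z :=
  Finset.analyticAt_fun_prod _ fun j _ =>
    (analyticAt_const.mul (A.analyticAt_fC j z)).cpow analyticAt_const (hz j)

/- Both sides are holomorphic in `ρ` on a half-plane, and up to a real point of its boundary that
the rotation sends into `Δ_X`, where both are the real product. -/
lemma branch_rotate {X : A.Vertex} {σ : ℝ} {ρ : ℂ} (hρ : 0 < σ * ρ.im) {x : Fin k → ℝ}
    (hx : x ∈ A.cone X) :
    A.branch X σ (A.rotate X ρ x) = A.principalBranch X (A.rotate X ρ x) := by
  obtain ⟨D, -, -, -, hcone, hincl, hana, hreal⟩ := A.branch_spec X σ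
  obtain ⟨r₀, hr₀⟩ := exists_add_smul_mem_domainAt hx
  set T : Set ℂ := insert (r₀ : ℂ) {w : ℂ | 0 < σ * w.im}
  have hTD : ∀ w ∈ T, A.rotate X w x ∈ D := by
    rintro w (rfl | (hw : 0 < σ * w.im))
    · exact hincl ⟨_, hr₀, (rotate_ofReal X r₀ x).symm⟩
    · have hw0 : w ≠ 0 := fun h => by simp [h] at hw
      refine hcone _ ?_ ?_ (rotate_mem_rotatedCone hx hw0)
      · simp [hw0]
      · rw [Complex.im_ofReal_mul, mul_left_comm]
        exact mul_pos (inv_pos.2 (norm_pos_iff.2 hw0)) hw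
  have hTslit : ∀ w ∈ T, ∀ j, (A.side X j : ℂ) * A.fC j (A.rotate X w x) ∈ Complex.slitPlane := by
    rintro w (rfl | (hw : 0 < σ * w.im)) j
    · rw [rotate_ofReal]
      exact side_mul_fC_incl_mem_slitPlane hr₀ j
    · exact side_mul_fC_rotate_mem_slitPlane hx (right_ne_zero_of_mul hw.ne') j
  have hreal_eq : ∀ᶠ r : ℝ in 𝓝[≠] r₀,
      A.branch X σ (A.rotate X r x) = A.principalBranch X (A.rotate X r x) := by
    have hcont : Continuous fun r : ℝ => A.point X + r • (x - A.point X) := by fun_prop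
    rw [A.domainAt_eq_chamber] at hr₀
    filter_upwards [nhdsWithin_le_nhds
      (hcont.continuousAt.preimage_mem_nhds ((A.isOpen_chamber _).mem_nhds hr₀))] with r hr
    rw [mem_preimage, ← A.domainAt_eq_chamber] at hr
    rw [rotate_ofReal, hreal _ hr, principalBranch_incl hr]
  have hfreq : ∃ᶠ w in 𝓝[≠] (r₀ : ℂ),
      A.branch X σ (A.rotate X w x) = A.principalBranch X (A.rotate X w x) :=
    (Complex.continuous_ofReal.continuousAt.tendsto.inf (tendsto_principal_principal.2
      fun _ h => Complex.ofReal_injective.ne h)).frequently hreal_eq.frequently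
  exact AnalyticOnNhd.eqOn_of_preconnected_of_frequently_eq
    (fun w hw => (hana _ (hTD w hw)).comp_of_eq (analyticAt_rotate X x w) rfl)
    (fun w hw => (analyticAt_principalBranch (hTslit w hw)).comp_of_eq
      (analyticAt_rotate X x w) rfl)
    (isPreconnected_insert_setOf_mul_im_pos (left_ne_zero_of_mul hρ.ne') r₀)
    (mem_insert _ _) hfreq (mem_insert_of_mem _ hρ)

/-! ### Domination of the integrands -/

variable (A)

/-- The linear map whose components are the forms `l j` of the hyperplanes of a vertex, used as
a change of variables. -/
noncomputable def formsMap (X : A.Vertex) : (Fin k → ℝ) →ₗ[ℝ] (Fin k → ℝ) :=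
  LinearMap.pi fun r => A.l (X.1.orderEmbOfFin X.2 r)

lemma det_formsMap_ne_zero (X : A.Vertex) : LinearMap.det (A.formsMap X) ≠ 0 := by
  refine (LinearMap.isUnit_det _ ((LinearMap.isUnit_iff_ker_eq_bot _).2 ?_)).ne_zero
  refine LinearMap.ker_eq_bot'.2 fun v hv => A.eq_zero_of_l X v fun j hj => ?_
  rw [← X.1.mem_coe, ← Finset.range_orderEmbOfFin X.1 X.2] at hj
  obtain ⟨r, rfl⟩ := hj
  exact congrFun hv r

lemma integrable_prod_forms (X : A.Vertex) (φ : Fin N → ℝ → ℝ) (hφ : ∀ j, Integrable (φ j)) :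
    Integrable fun x => ∏ j ∈ X.1, φ j (A.f j x) := by
  set e := X.1.orderEmbOfFin X.2
  have hprod : Integrable fun y : Fin k → ℝ => ∏ r, φ (e r) (y r + A.f (e r) 0) :=
    Integrable.fintype_prod (μ := fun _ : Fin k => (volume : Measure ℝ))
      (f := fun r y => φ (e r) (y + A.f (e r) 0)) fun r => (hφ _).comp_add_right _
  have hcomp : (fun x => ∏ j ∈ X.1, φ j (A.f j x)) =
      (fun y : Fin k → ℝ => ∏ r, φ (e r) (y r + A.f (e r) 0)) ∘ A.formsMap X := by
    ext x
    conv_lhs => rw [← Finset.map_orderEmbOfFin_univ X.1 X.2, Finset.prod_map]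
    refine Finset.prod_congr rfl fun r _ => congrArg (φ (e r)) ?_
    rw [add_comm]
    exact (zero_add x ▸ A.f_add (e r) 0 x :)
  rw [hcomp]
  refine Integrable.comp_measurable ?_
    (LinearMap.continuous_of_finiteDimensional (A.formsMap X)).measurable
  rw [Measure.map_linearMap_addHaar_eq_smul_addHaar _ (A.det_formsMap_ne_zero X)]
  exact hprod.smul_measure ENNReal.ofReal_ne_top

/-- The density on `ℂ^k` of the form `e^{-λ f0} (∏ j, |f j| ^ α j) ω_{X'}`, with the determination
by principal powers. -/
noncomputable def principalIntegrand (X : A.Vertex) (lam : ℝ) (X' : A.Vertex) (z : Fin k → ℂ) : ℂ :=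
  Complex.exp (-lam * complexify A.f0 z) * A.principalBranch X z * A.omega X' z stdVec

/-- The pullback of `principalIntegrand` to `ℝ^k` under `x ↦ X + t (x - X)`: the integrand of
`I_X^ρ` with an arbitrary complex factor `t` in place of `ρ`. -/
noncomputable def scaledIntegrand (X : A.Vertex) (lam : ℝ) (X' : A.Vertex) (t : ℂ)
    (x : Fin k → ℝ) : ℂ :=
  t ^ k * A.principalIntegrand X lam X' (A.rotate X t x)

variable {A}

lemma omega_smul (X : A.Vertex) (z : Fin k → ℂ) (t : ℂ) :
    (A.omega X z fun s => t • stdVec s) = t ^ k * A.omega X z stdVec := by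
  have hwedge : (A.wedge X fun s => t • stdVec s) = t ^ k * A.wedge X stdVec := by
    have hdet := Matrix.det_smul (.of fun r s => complexify (A.l (X.1.orderEmbOfFin X.2 r))
      (stdVec s)) t
    rw [Fintype.card_fin] at hdet
    simp only [wedge, complexify_smul, ← hdet]
    rfl
  rw [omega, omega, hwedge]
  ring

lemma norm_principalBranch (X : A.Vertex) (z : Fin k → ℂ) :
    ‖A.principalBranch X z‖ = ∏ j, ‖A.fC j z‖ ^ A.α j := by
  rw [principalBranch, norm_prod]
  refine Finset.prod_congr rfl fun j _ => ?_
  rw [Complex.norm_cpow_real, norm_mul, Complex.norm_real, Real.norm_eq_abs, abs_side, one_mul]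

lemma complexify_f0_rotate (X : A.Vertex) (t : ℂ) (x : Fin k → ℝ) :
    complexify A.f0 (A.rotate X t x) = A.f0 (A.point X) + t * A.f0 (x - A.point X) := by
  rw [rotate, complexify_add, complexify_smul, complexify_incl, complexify_incl]

lemma norm_exp_rotate (X : A.Vertex) (lam : ℝ) (t : ℂ) (x : Fin k → ℝ) :
    ‖Complex.exp (-lam * complexify A.f0 (A.rotate X t x))‖ =
      Real.exp (-lam * A.f0 (A.point X)) * Real.exp (-lam * t.re * A.f0 (x - A.point X)) := by
  rw [Complex.norm_exp, complexify_f0_rotate, ← Real.exp_add, ← Complex.ofReal_neg,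
    Complex.re_ofReal_mul, Complex.add_re, Complex.re_mul_ofReal, Complex.ofReal_re]
  ring_nf

lemma norm_scaledIntegrand (X X' : A.Vertex) (lam : ℝ) (t : ℂ) (x : Fin k → ℝ) :
    ‖A.scaledIntegrand X lam X' t x‖ =
      Real.exp (-lam * A.f0 (A.point X)) * Real.exp (-lam * t.re * A.f0 (x - A.point X)) *
      ((∏ j, ‖A.fC j (A.rotate X t x)‖ ^ A.α j) * ∏ j ∈ X'.1, ‖A.fC j (A.rotate X t x)‖⁻¹) *
      (‖t‖ ^ k * ‖(A.orientSign X' : ℂ) * A.wedge X' stdVec‖) := by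
  rw [scaledIntegrand, principalIntegrand, omega, norm_mul, norm_mul, norm_mul, norm_mul, norm_pow,
    norm_exp_rotate, norm_principalBranch, norm_inv, norm_prod, Finset.prod_inv_distrib]
  ring

lemma f0_sub_pos {X : A.Vertex} {x : Fin k → ℝ} (hx : x ∈ A.cone X) :
    0 < A.f0 (x - A.point X) := by
  obtain ⟨a, ha, rfl⟩ := hx
  rw [add_sub_cancel_left, map_sum]
  have := A.nonempty_indices X
  refine Finset.sum_pos (fun j _ => ?_) Finset.univ_nonempty
  rw [map_smul, A.f0_edge, smul_eq_mul, mul_one]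
  exact ha j

lemma exists_abs_l_le (X : A.Vertex) (j : Fin N) : ∃ C : ℝ, 0 ≤ C ∧ ∀ x ∈ A.cone X,
    |A.l j (x - A.point X)| ≤ C * A.f0 (x - A.point X) := by
  refine ⟨∑ i, |A.l j (A.edge X i)|, Finset.sum_nonneg fun _ _ => abs_nonneg _, ?_⟩
  rintro x ⟨a, ha, rfl⟩
  rw [add_sub_cancel_left, map_sum, map_sum, Finset.mul_sum]
  refine (Finset.abs_sum_le_sum_abs _ _).trans (Finset.sum_le_sum fun i _ => ?_)
  rw [map_smul, map_smul, A.f0_edge, smul_eq_mul, smul_eq_mul, mul_one, abs_mul,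
    abs_of_pos (ha i), mul_comm]
  gcongr
  · exact (ha i).le
  · exact Finset.single_le_sum (f := fun i => |A.l j (A.edge X i)|) (fun _ _ => abs_nonneg _)
      (Finset.mem_univ i)

lemma exists_norm_fC_rotate_le (X : A.Vertex) : ∃ K : ℝ, 1 ≤ K ∧ ∀ x ∈ A.cone X, ∀ (t : ℂ) j,
    ‖A.fC j (A.rotate X t x)‖ ≤ K * (1 + ‖t‖ * A.f0 (x - A.point X)) := by
  choose C hC hCl using A.exists_abs_l_le X
  set K : Fin N → ℝ := fun j => |A.f j (A.point X)| + C j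
  have hK : ∀ j, 0 ≤ K j := fun j => add_nonneg (abs_nonneg _) (hC j)
  refine ⟨1 + ∑ j, K j, le_add_of_nonneg_right (Finset.sum_nonneg fun j _ => hK j),
    fun x hx t j => ?_⟩
  have hpos := f0_sub_pos hx
  calc ‖A.fC j (A.rotate X t x)‖
      ≤ |A.f j (A.point X)| + ‖t‖ * |A.l j (x - A.point X)| := by
        rw [A.fC_rotate]
        refine (norm_add_le _ _).trans_eq ?_
        rw [norm_mul, Complex.norm_real, Complex.norm_real, Real.norm_eq_abs, Real.norm_eq_abs]
    _ ≤ K j * 1 + K j * (‖t‖ * A.f0 (x - A.point X)) := by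
        rw [mul_one, mul_left_comm]
        gcongr
        · exact le_add_of_nonneg_right (hC j)
        · exact (hCl j x hx).trans (by gcongr; exact le_add_of_nonneg_left (abs_nonneg _))
    _ ≤ (1 + ∑ j, K j) * (1 + ‖t‖ * A.f0 (x - A.point X)) := by
        rw [← mul_add]
        gcongr
        exact (Finset.single_le_sum (fun j _ => hK j) (Finset.mem_univ j)).trans (by linarith)

lemma abs_f_le_of_mem_admissible {M δ : ℝ} {t : ℂ} (ht : t ∈ admissible M δ) (X : A.Vertex)
    (x : Fin k → ℝ) (j : Fin N) : |A.f j x| ≤ M * ‖A.fC j (A.rotate X t x)‖ := by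
  rw [A.fC_rotate, show A.f j x = A.f j (A.point X) + A.l j (x - A.point X) by rw [l_sub]; ring]
  exact ht.2.2 _ _

lemma exists_norm_scaledIntegrand_le (X X' : A.Vertex) {lam M δ : ℝ} (hlam : 0 < lam) (hM : 1 ≤ M)
    (hδ : 0 < δ) : ∃ C η : ℝ, 0 < η ∧ ∀ x ∈ A.cone X, x ∈ A.compl → ∀ t ∈ admissible M δ,
      ‖A.scaledIntegrand X lam X' t x‖ ≤ C * ∏ j ∈ X'.1,
        (M⁻¹ * |A.f j x|) ^ (min (A.α j) 1 - 1) * Real.exp (-η * |A.f j x|) := by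
  obtain ⟨K, hK, hKle⟩ := exists_norm_fC_rotate_le X
  have hM0 : 0 < M := one_pos.trans_le hM
  have hcard : 0 < X'.1.card := A.k_pos.trans_eq X'.2.symm
  set b : ℝ := lam * δ / (2 * (K * M))
  set m : ℝ := ∑ j, A.α j
  set W : ℝ := ‖(A.orientSign X' : ℂ) * A.wedge X' stdVec‖
  refine ⟨Real.exp (-lam * A.f0 (A.point X)) * Real.exp (lam * δ / M) * (m / b) ^ m *
    (M ^ k * W), b / X'.1.card, by positivity, fun x hx hxc t ht => ?_⟩
  set h := A.f0 (x - A.point X)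
  have hh : 0 < h := f0_sub_pos hx
  set p : ℝ := K * (1 + M * h)
  have hup : ∀ s : ℂ, ‖s‖ ≤ M → ∀ j, ‖A.fC j (A.rotate X s x)‖ ≤ p := fun s hs j =>
    (hKle x hx s j).trans (by unfold p; gcongr)
  have hfp : ∀ j, |A.f j x| ≤ p := fun j => by
    have hone := hup ((1 : ℝ) : ℂ) (by simpa using hM) j
    rwa [rotate_ofReal, one_smul, add_sub_cancel, A.fC_incl, Complex.norm_real,
      Real.norm_eq_abs] at hone
  have hp : 1 ≤ p := one_le_mul_of_one_le_of_one_le hK (by nlinarith)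
  rw [norm_scaledIntegrand]
  set U := (∏ j, ‖A.fC j (A.rotate X t x)‖ ^ A.α j) * ∏ j ∈ X'.1, ‖A.fC j (A.rotate X t x)‖⁻¹
  calc _ ≤ Real.exp (-lam * A.f0 (A.point X)) *
          (Real.exp (lam * δ / M) * Real.exp (-(2 * b * p))) * U * (M ^ k * W) := by
        gcongr
        · exact exp_neg_mul_le_mul_exp hlam.le (one_pos.trans_le hK) hM0 hh.le ht.2.1
        · exact ht.1
    _ = Real.exp (-lam * A.f0 (A.point X)) * Real.exp (lam * δ / M) *
          (Real.exp (-(2 * b * p)) * U) * (M ^ k * W) := by ring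
    _ ≤ Real.exp (-lam * A.f0 (A.point X)) * Real.exp (lam * δ / M) *
          ((m / b) ^ m * ∏ j ∈ X'.1, (M⁻¹ * |A.f j x|) ^ (min (A.α j) 1 - 1) *
            Real.exp (-(b / X'.1.card) * |A.f j x|)) * (M ^ k * W) := by
        gcongr _ * ?_ * _
        exact exp_mul_prod_rpow_mul_prod_inv_le (Finset.card_pos.1 hcard) A.α_pos
          (fun j => mul_pos (inv_pos.2 hM0) (abs_pos.2 (hxc j)))
          (fun j => (inv_mul_le_iff₀ hM0).2 (abs_f_le_of_mem_admissible ht X x j))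
          (hup t ht.1) hfp hp (by positivity)
    _ = _ := by ring

lemma exists_integrable_bound (X X' : A.Vertex) {lam M δ : ℝ} (hlam : 0 < lam) (hM : 1 ≤ M)
    (hδ : 0 < δ) : ∃ B : (Fin k → ℝ) → ℝ, Integrable B ∧ ∀ x ∈ A.cone X, x ∈ A.compl →
      ∀ t ∈ admissible M δ, ‖A.scaledIntegrand X lam X' t x‖ ≤ B x := by
  obtain ⟨C, η, hη, hC⟩ := exists_norm_scaledIntegrand_le X X' hlam hM hδ
  refine ⟨_, Integrable.const_mul (A.integrable_prod_forms X' (fun j y =>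
    (M⁻¹ * |y|) ^ (min (A.α j) 1 - 1) * Real.exp (-η * |y|)) fun j => ?_) C, hC⟩
  have hexponent : -1 < min (A.α j) 1 - 1 := by linarith [lt_min (A.α_pos j) one_pos]
  refine ((integrable_abs_rpow_mul_exp hexponent hη).const_mul
    (M⁻¹ ^ (min (A.α j) 1 - 1))).congr (Eventually.of_forall fun y => ?_)
  beta_reduce
  rw [Real.mul_rpow (by positivity) (abs_nonneg _), mul_assoc]

/-! ### Independence of the rotation -/

lemma ae_mem_compl : ∀ᵐ x : Fin k → ℝ, x ∈ A.compl := by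
  refine ae_all_iff.2 fun j => ?_
  obtain ⟨X, hX⟩ := A.exists_vertex_superset ((Finset.card_singleton j).trans_le A.k_pos)
  have hne : AffineSubspace.mk' (A.point X) (LinearMap.ker (A.l j)) ≠ ⊤ := fun h => by
    have hker := congrArg AffineSubspace.direction h
    rw [AffineSubspace.direction_mk', AffineSubspace.direction_top, LinearMap.ker_eq_top] at hker
    exact A.l_edge_self X ⟨j, hX (Finset.mem_singleton_self j)⟩ (by rw [hker]; rfl)
  refine measure_mono_null (fun x hx => ?_) (Measure.addHaar_affineSubspace volume _ hne)
  rw [SetLike.mem_coe, AffineSubspace.mem_mk', vsub_eq_sub, LinearMap.mem_ker,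
    A.l_sub_point X (hX (Finset.mem_singleton_self j))]
  simpa using hx

lemma ae_mem_cone_inter_compl (X : A.Vertex) :
    ∀ᵐ x ∂(volume.restrict (A.cone X)), x ∈ A.cone X ∧ x ∈ A.compl :=
  (ae_restrict_mem (A.isOpen_cone X).measurableSet).and (ae_restrict_of_ae ae_mem_compl)

lemma analyticAt_complexify (φ : (Fin k → ℝ) →ₗ[ℝ] ℝ) (z : Fin k → ℂ) :
    AnalyticAt ℂ (complexify φ) z :=
  Finset.analyticAt_fun_sum _ fun i _ =>
    ((ContinuousLinearMap.proj (R := ℂ) (φ := fun _ : Fin k => ℂ) i).analyticAt z).mul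
      analyticAt_const

lemma analyticAt_omega (X : A.Vertex) {z : Fin k → ℂ} (hz : ∀ j, A.fC j z ≠ 0) :
    AnalyticAt ℂ (fun z => A.omega X z stdVec) z :=
  ((Finset.analyticAt_fun_prod _ fun j _ => A.analyticAt_fC j z).inv
    (Finset.prod_ne_zero_iff.2 fun j _ => hz j)).mul analyticAt_const

lemma analyticAt_principalIntegrand (X X' : A.Vertex) (lam : ℝ) {x : Fin k → ℝ} (hx : x ∈ A.cone X)
    {t : ℂ} (ht : t.im ≠ 0) :
    AnalyticAt ℂ (A.principalIntegrand X lam X') (A.rotate X t x) := by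
  have hslit := side_mul_fC_rotate_mem_slitPlane hx ht
  exact ((analyticAt_const.mul (analyticAt_complexify A.f0 _)).cexp.mul
    (analyticAt_principalBranch hslit)).mul
    (analyticAt_omega X' fun j => right_ne_zero_of_mul (Complex.slitPlane_ne_zero (hslit j)))

lemma differentiableAt_scaledIntegrand (X X' : A.Vertex) (lam : ℝ) {t : ℂ} (ht : t.im ≠ 0)
    {x : Fin k → ℝ} (hx : x ∈ A.cone X) :
    DifferentiableAt ℂ (fun t => A.scaledIntegrand X lam X' t x) t :=
  ((analyticAt_id.pow k).mul ((analyticAt_principalIntegrand X X' lam hx ht).comp_of_eq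
    (analyticAt_rotate X x t) rfl)).differentiableAt

lemma continuous_incl : Continuous (incl : (Fin k → ℝ) → Fin k → ℂ) :=
  continuous_pi fun i => Complex.continuous_ofReal.comp (continuous_apply i)

lemma continuous_rotate (X : A.Vertex) (t : ℂ) : Continuous (A.rotate X t) :=
  continuous_const.add ((continuous_incl.comp (continuous_sub_right _)).const_smul t)

lemma aestronglyMeasurable_scaledIntegrand (X X' : A.Vertex) (lam : ℝ) {t : ℂ} (ht : t.im ≠ 0) :
    AEStronglyMeasurable (A.scaledIntegrand X lam X' t) (volume.restrict (A.cone X)) := by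
  refine ContinuousOn.aestronglyMeasurable (fun x hx => ?_) (A.isOpen_cone X).measurableSet
  exact (continuousAt_const.mul ((analyticAt_principalIntegrand X X' lam hx ht).continuousAt.comp
    (continuous_rotate X t).continuousAt)).continuousWithinAt

lemma exists_integrable_bound_nhds (X X' : A.Vertex) {lam : ℝ} (hlam : 0 < lam) {t₀ : ℂ}
    (hre : 0 < t₀.re) (him : t₀.im ≠ 0) :
    ∃ B : (Fin k → ℝ) → ℝ, Integrable B ∧ ∃ U ∈ 𝓝 t₀, ∀ᵐ x ∂volume.restrict (A.cone X),
      ∀ t ∈ U, ‖A.scaledIntegrand X lam X' t x‖ ≤ B x := by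
  obtain ⟨M, δ, hM, hδ, hU⟩ := exists_admissible_mem_nhds hre him
  obtain ⟨B, hB, hbound⟩ := exists_integrable_bound X X' hlam hM hδ
  exact ⟨B, hB, _, hU, (ae_mem_cone_inter_compl X).mono fun x hx => hbound x hx.1 hx.2⟩

lemma integrableOn_scaledIntegrand (X X' : A.Vertex) {lam : ℝ} (hlam : 0 < lam) {t : ℂ}
    (hre : 0 < t.re) (him : t.im ≠ 0) :
    IntegrableOn (A.scaledIntegrand X lam X' t) (A.cone X) := by
  obtain ⟨B, hB, U, hU, hbound⟩ := exists_integrable_bound_nhds X X' hlam hre him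
  exact hB.restrict.mono' (aestronglyMeasurable_scaledIntegrand X X' lam him)
    (hbound.mono fun x hx => hx t (mem_of_mem_nhds hU))

lemma differentiableAt_integral_scaledIntegrand (X X' : A.Vertex) {lam : ℝ} (hlam : 0 < lam)
    {t : ℂ} (hre : 0 < t.re) (him : t.im ≠ 0) :
    DifferentiableAt ℂ (fun t => ∫ x in A.cone X, A.scaledIntegrand X lam X' t x) t := by
  obtain ⟨B, hB, U, hU, hbound⟩ := exists_integrable_bound_nhds X X' hlam hre him
  refine differentiableAt_integral_of_dominated (U := U ∩ {t | t.im ≠ 0})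
    (inter_mem hU (Complex.continuous_im.continuousAt.eventually_ne him)) hB.restrict
    (fun t ht => aestronglyMeasurable_scaledIntegrand X X' lam ht.2) ?_
    (hbound.mono fun x hx t ht => hx t ht.1)
  filter_upwards [ae_mem_cone_inter_compl X] with x hx t ht
  exact (differentiableAt_scaledIntegrand X X' lam ht.2 hx.1).differentiableWithinAt

lemma integral_scaledIntegrand_ofReal_mul (X X' : A.Vertex) (lam : ℝ) (t : ℂ) {r : ℝ}
    (hr : 0 < r) :
    ∫ x in A.cone X, A.scaledIntegrand X lam X' (r * t) x =
      ∫ x in A.cone X, A.scaledIntegrand X lam X' t x := by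
  have hmeas := (A.isOpen_cone X).measurableSet
  set G : (Fin k → ℝ) → ℂ := (A.cone X).indicator (A.scaledIntegrand X lam X' t) with hG
  have hdilate : (A.cone X).indicator (A.scaledIntegrand X lam X' (r * t)) =
      fun x => (r : ℂ) ^ k * G (A.point X + r • (x - A.point X)) := by
    funext x
    have hmem := A.add_smul_mem_cone X hr (x := x)
    by_cases hx : x ∈ A.cone X
    · rw [hG, indicator_of_mem hx, indicator_of_mem (hmem.2 hx), scaledIntegrand, scaledIntegrand,
        rotate_ofReal_mul, mul_pow, mul_assoc]
    · rw [hG, indicator_of_notMem hx, indicator_of_notMem (mt hmem.1 hx), mul_zero]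
  rw [← integral_indicator hmeas, ← integral_indicator hmeas, hdilate, integral_const_mul,
    integral_sub_right_eq_self (fun x => G (A.point X + r • x)) (A.point X),
    Measure.integral_comp_smul volume (fun x => G (A.point X + x)) r,
    integral_add_left_eq_self G (A.point X), Module.finrank_fin_fun,
    abs_of_pos (by positivity), Complex.real_smul, ← mul_assoc, ← Complex.ofReal_pow,
    ← Complex.ofReal_mul, mul_inv_cancel₀ (by positivity), Complex.ofReal_one, one_mul]

lemma integral_scaledIntegrand_eq_of_mem_sector (X X' : A.Vertex) {lam σ : ℝ} (hlam : 0 < lam)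
    {t t' : ℂ} (ht : t ∈ sector σ) (ht' : t' ∈ sector σ) :
    ∫ x in A.cone X, A.scaledIntegrand X lam X' t x =
      ∫ x in A.cone X, A.scaledIntegrand X lam X' t' x := by
  have hdiff : ∀ s ∈ sector σ, DifferentiableAt ℂ
      (fun s => ∫ x in A.cone X, A.scaledIntegrand X lam X' s x) s := fun s hs =>
    differentiableAt_integral_scaledIntegrand X X' hlam hs.1 (im_ne_zero_of_mem_sector hs)
  refine (isOpen_sector σ).is_const_of_deriv_eq_zero (convex_sector σ).isPreconnected
    (fun s hs => (hdiff s hs).differentiableWithinAt) (fun s hs => ?_) ht ht'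
  refine deriv_eq_zero_of_eventually_eq_dilation (fun h => ?_) (hdiff s hs) ?_
  · exact im_ne_zero_of_mem_sector hs (by rw [h, Complex.zero_im])
  · filter_upwards [lt_mem_nhds one_pos] with r hr
    exact integral_scaledIntegrand_ofReal_mul X X' lam s hr

/-! ### Passage to the real cones -/

variable (A) in
/-- The factor acquired by `∏ j, |f j| ^ α j` on continuation from the domain of signs `s` to the
domain of `x` along paths that pass each hyperplane on the side `σ`. -/
noncomputable def phase (σ : ℝ) (s : Fin N → ℝ) (x : Fin k → ℝ) : ℂ :=
  ∏ j, if s j * A.f j x < 0 then Complex.exp (-(σ * Complex.I * Real.pi * A.α j)) else 1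

lemma norm_phase (σ : ℝ) (s : Fin N → ℝ) (x : Fin k → ℝ) : ‖A.phase σ s x‖ = 1 := by
  rw [phase, norm_prod]
  refine Finset.prod_eq_one fun j _ => ?_
  split_ifs
  · simp [Complex.norm_exp]
  · exact norm_one

lemma measurable_phase (σ : ℝ) (s : Fin N → ℝ) : Measurable (A.phase σ s) :=
  Finset.measurable_fun_prod _ fun j _ => Measurable.ite
    (isOpen_lt (continuous_const.mul (A.continuous_f j)) continuous_const).measurableSet
    measurable_const measurable_const

lemma phase_eq_one {s : Fin N → ℝ} {x : Fin k → ℝ} (hx : x ∈ A.chamber s) (σ : ℝ) :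
    A.phase σ s x = 1 :=
  Finset.prod_eq_one fun j _ => if_neg (hx j).not_gt

lemma rotate_one (X : A.Vertex) (x : Fin k → ℝ) : A.rotate X 1 x = incl x := by
  rw [← Complex.ofReal_one, rotate_ofReal, one_smul, add_sub_cancel]

lemma fC_incl_ne_zero {x : Fin k → ℝ} (hx : x ∈ A.compl) (j : Fin N) : A.fC j (incl x) ≠ 0 := by
  rw [A.fC_incl]
  exact Complex.ofReal_ne_zero.2 (hx j)

lemma continuousAt_domainIntegrand (X : A.Vertex) (lam : ℝ) {x : Fin k → ℝ} (hx : x ∈ A.compl) :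
    ContinuousAt (A.domainIntegrand lam X) x := by
  have hf0 : Continuous A.f0 := A.f0.continuous_of_finiteDimensional
  refine ((by fun_prop : ContinuousAt (fun x => Complex.exp (-lam * A.f0 x)) x).mul
    (Complex.continuous_ofReal.continuousAt.comp (tendsto_finsetProd _ fun j _ =>
      (A.continuous_f j).abs.continuousAt.rpow_const (Or.inr (A.α_pos j).le)))).mul ?_
  exact (analyticAt_omega X (fC_incl_ne_zero hx)).continuousAt.comp_of_eq
    continuous_incl.continuousAt rfl

lemma isOpen_compl : IsOpen A.compl := by
  rw [compl, Set.ofPred_forall]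
  exact isOpen_iInter_of_finite fun j => isOpen_ne_fun (A.continuous_f j) continuous_const

lemma aestronglyMeasurable_domainIntegrand (X : A.Vertex) (lam : ℝ) :
    AEStronglyMeasurable (A.domainIntegrand lam X) := by
  rw [← Measure.restrict_eq_self_of_ae_mem (ae_mem_compl (A := A))]
  exact ContinuousOn.aestronglyMeasurable (fun x hx =>
    (continuousAt_domainIntegrand X lam hx).continuousWithinAt) isOpen_compl.measurableSet

lemma norm_domainIntegrand (X X' : A.Vertex) (lam : ℝ) (x : Fin k → ℝ) :
    ‖A.domainIntegrand lam X' x‖ = ‖A.scaledIntegrand X lam X' 1 x‖ := by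
  have hprod : ‖((∏ j, |A.f j x| ^ A.α j : ℝ) : ℂ)‖ = ‖A.principalBranch X (incl x)‖ := by
    simp only [norm_principalBranch, A.fC_incl, Complex.norm_real, Real.norm_eq_abs]
    exact abs_of_nonneg (by positivity)
  rw [domainIntegrand, scaledIntegrand, principalIntegrand, rotate_one, complexify_incl, one_pow,
    one_mul, norm_mul, norm_mul, hprod, norm_mul, norm_mul]

lemma integrableOn_domainIntegrand_cone (X X' : A.Vertex) {lam : ℝ} (hlam : 0 < lam) :
    IntegrableOn (A.domainIntegrand lam X') (A.cone X) := by
  obtain ⟨B, hB, hbound⟩ := exists_integrable_bound X X' hlam le_rfl one_pos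
  refine hB.restrict.mono' (aestronglyMeasurable_domainIntegrand X' lam).restrict ?_
  filter_upwards [ae_mem_cone_inter_compl X] with x hx
  rw [norm_domainIntegrand X]
  refine hbound x hx.1 hx.2 1 ⟨norm_one.le, le_rfl, fun a b => ?_⟩
  rw [one_mul, one_mul, ← Complex.ofReal_add, Complex.norm_real, Real.norm_eq_abs]

lemma integrableOn_domainIntegrand_mul_phase (X X' : A.Vertex) {lam : ℝ} (hlam : 0 < lam)
    (σ : ℝ) (s : Fin N → ℝ) :
    IntegrableOn (fun x => A.domainIntegrand lam X' x * A.phase σ s x) (A.cone X) :=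
  Integrable.mono (integrableOn_domainIntegrand_cone X X' hlam)
    ((aestronglyMeasurable_domainIntegrand X' lam).mul
      (measurable_phase σ s).aestronglyMeasurable).restrict
    (Eventually.of_forall fun x => by rw [norm_mul, norm_phase, mul_one])

/- On a cone, `± f j` is positive at the vertex, so once negative at `x` it decreases along the ray
towards `x`: this determines the half-plane in which `± f j` lies at the rotated point. -/
lemma side_mul_fC_rotate_im_neg {X : A.Vertex} {σ : ℝ} {t : ℂ} (ht : t ∈ sector σ)
    {x : Fin k → ℝ} (hx : x ∈ A.cone X) {j : Fin N} (hneg : A.side X j * A.f j x < 0) :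
    σ * ((A.side X j : ℂ) * A.fC j (A.rotate X t x)).im < 0 := by
  have hj : j ∉ X.1 := fun hj => ((A.mem_cone_iff X x).1 hx j hj).not_gt hneg
  have hl : A.side X j * A.l j (x - A.point X) < 0 := by
    rw [A.l_sub, mul_sub]
    linarith [A.side_mul_f_point_pos X hj]
  have him : ((A.side X j : ℂ) * A.fC j (A.rotate X t x)).im =
      t.im * (A.side X j * A.l j (x - A.point X)) := by
    rw [A.fC_rotate, Complex.im_ofReal_mul, Complex.add_im, Complex.ofReal_im, zero_add,
      Complex.im_mul_ofReal, mul_left_comm]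
  rw [him, ← mul_assoc]
  exact mul_neg_of_pos_of_neg ht.2 hl

lemma tendsto_rotate_nhds_one (X : A.Vertex) (x : Fin k → ℝ) (S : Set ℂ) :
    Tendsto (fun t => A.rotate X t x) (𝓝[S] 1) (𝓝 (incl x)) := by
  rw [← rotate_one X]
  exact (analyticAt_rotate X x 1).continuousAt.tendsto.mono_left nhdsWithin_le_nhds

lemma tendsto_principalBranch {X : A.Vertex} {σ : ℝ} (hσ : σ = -1 ∨ σ = 1) {x : Fin k → ℝ}
    (hx : x ∈ A.cone X) (hxc : x ∈ A.compl) :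
    Tendsto (fun t => A.principalBranch X (A.rotate X t x)) (𝓝[sector σ] 1)
      (𝓝 (((∏ j, |A.f j x| ^ A.α j : ℝ) : ℂ) * A.phase σ (A.side X) x)) := by
  rw [Complex.ofReal_prod, phase, ← Finset.prod_mul_distrib]
  refine tendsto_finsetProd _ fun j _ => ?_
  have hform : Tendsto (fun t => (A.side X j : ℂ) * A.fC j (A.rotate X t x)) (𝓝[sector σ] 1)
      (𝓝 ((A.side X j * A.f j x : ℝ) : ℂ)) := by
    rw [Complex.ofReal_mul, ← A.fC_incl]
    exact ((A.analyticAt_fC j _).continuousAt.tendsto.comp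
      (tendsto_rotate_nhds_one X x _)).const_mul _
  have habs : |A.f j x| = |A.side X j * A.f j x| := by rw [abs_mul, abs_side, one_mul]
  rw [habs]
  split_ifs with hneg
  · exact (tendsto_cpow_nhdsWithin_of_neg hσ hneg (A.α j)).comp (tendsto_nhdsWithin_iff.2
      ⟨hform, eventually_nhdsWithin_of_forall fun t ht => side_mul_fC_rotate_im_neg ht hx hneg⟩)
  · have hside : A.side X j ≠ 0 := abs_pos.1 (by rw [abs_side]; exact one_pos)
    have hpos : 0 < A.side X j * A.f j x :=
      (not_lt.1 hneg).lt_of_ne' (mul_ne_zero hside (hxc j))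
    rw [mul_one, Complex.ofReal_cpow (abs_nonneg _), abs_of_pos hpos]
    exact hform.cpow tendsto_const_nhds (Complex.ofReal_mem_slitPlane.2 hpos)

lemma tendsto_scaledIntegrand {X : A.Vertex} (X' : A.Vertex) (lam : ℝ) {σ : ℝ}
    (hσ : σ = -1 ∨ σ = 1) {x : Fin k → ℝ} (hx : x ∈ A.cone X) (hxc : x ∈ A.compl) :
    Tendsto (fun t => A.scaledIntegrand X lam X' t x) (𝓝[sector σ] 1)
      (𝓝 (A.domainIntegrand lam X' x * A.phase σ (A.side X) x)) := by
  have hrot := tendsto_rotate_nhds_one X x (sector σ)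
  have hpow : Tendsto (fun t : ℂ => t ^ k) (𝓝[sector σ] 1) (𝓝 (1 ^ k)) :=
    ((continuous_pow k).tendsto 1).mono_left nhdsWithin_le_nhds
  have hexp := (((analyticAt_complexify A.f0 _).continuousAt.tendsto.comp hrot).const_mul
    (-lam : ℂ)).cexp
  have homega := (analyticAt_omega X' (fC_incl_ne_zero hxc)).continuousAt.tendsto.comp hrot
  convert hpow.mul ((hexp.mul (tendsto_principalBranch hσ hx hxc)).mul homega) using 2
  · rfl
  · rw [domainIntegrand, complexify_incl]
    ring

variable (A) in
/-- The limit of `I_X^ρ(λ)` as `ρ → 1` with `Im ρ` of the sign of `σ`, as an integral over the real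
cone `C_X^+`. -/
noncomputable def integralBoundary (σ : ℝ) (X : A.Vertex) (lam : ℝ) : A.Vertex → ℂ := fun X' =>
  ∫ x in A.cone X, A.domainIntegrand lam X' x * A.phase σ (A.side X) x

lemma integral_scaledIntegrand_eq (X X' : A.Vertex) {lam σ : ℝ} (hlam : 0 < lam)
    (hσ : σ = -1 ∨ σ = 1) {t : ℂ} (ht : t ∈ sector σ) :
    ∫ x in A.cone X, A.scaledIntegrand X lam X' t x = A.integralBoundary σ X lam X' := by
  have habs : |σ| = 1 := by rcases hσ with rfl | rfl <;> simp
  have hlim := tendsto_one_add_mul_I_nhdsWithin_sector (abs_pos.1 (habs.symm ▸ one_pos))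
  have hsector := (tendsto_nhdsWithin_iff.1 hlim).2
  obtain ⟨B, hB, hbound⟩ := exists_integrable_bound X X' hlam one_le_two one_pos
  refine tendsto_nhds_unique (l := 𝓝[>] (0 : ℝ))
    (tendsto_const_nhds.congr' (hsector.mono fun ε hε =>
      integral_scaledIntegrand_eq_of_mem_sector X X' hlam ht hε))
    (tendsto_integral_filter_of_dominated_convergence B ?_ ?_ hB.restrict ?_)
  · exact hsector.mono fun ε hε =>
      aestronglyMeasurable_scaledIntegrand X X' lam (im_ne_zero_of_mem_sector hε)
  · filter_upwards [Ioo_mem_nhdsGT one_pos] with ε hε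
    exact (ae_mem_cone_inter_compl X).mono fun x hx =>
      hbound x hx.1 hx.2 _ (one_add_mul_I_mem_admissible habs hε)
  · exact (ae_mem_cone_inter_compl X).mono fun x hx =>
      (tendsto_scaledIntegrand X' lam hσ hx.1 hx.2).comp hlim

lemma coneIntegrand_eq (X X' : A.Vertex) (lam : ℝ) {ρ : ℂ} (hρ : ρ.im ≠ 0) {x : Fin k → ℝ}
    (hx : x ∈ A.cone X) : A.coneIntegrand X ρ lam X' x = A.scaledIntegrand X lam X' ρ x := by
  rw [coneIntegrand, scaledIntegrand, principalIntegrand, omega_smul,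
    branch_rotate (Real.sign_mul_pos_of_ne_zero _ hρ) hx, mul_left_comm]

lemma integrableOn_coneIntegrand (X X' : A.Vertex) {lam : ℝ} (hlam : 0 < lam) {ρ : ℂ}
    (hre : 0 < ρ.re) (him : ρ.im ≠ 0) : IntegrableOn (A.coneIntegrand X ρ lam X') (A.cone X) :=
  (integrableOn_scaledIntegrand X X' hlam hre him).congr_fun
    (fun _ hx => (coneIntegrand_eq X X' lam him hx).symm) (A.isOpen_cone X).measurableSet

lemma integralCone_eq (X : A.Vertex) {lam σ : ℝ} (hlam : 0 < lam) (hσ : σ = -1 ∨ σ = 1) {ρ : ℂ}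
    (hρ : ρ ∈ sector σ) : A.integralCone X ρ lam = A.integralBoundary σ X lam := by
  funext X'
  rw [← integral_scaledIntegrand_eq X X' hlam hσ hρ]
  exact setIntegral_congr_fun (A.isOpen_cone X).measurableSet
    fun _ hx => coneIntegrand_eq X X' lam (im_ne_zero_of_mem_sector hρ) hx

lemma epsilon_integralCone_eq (X : A.Vertex) {lam σ : ℝ} (hlam : 0 < lam) (hσ : σ = -1 ∨ σ = 1)
    {p : ℂ → Prop} (hp : ∀ ρ, p ρ ↔ 0 < σ * ρ.im) :
    Classical.epsilon (fun c => ∀ ρ : ℂ, ‖ρ‖ = 1 → p ρ → 0 < (ρ * lam).re →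
      A.integralCone X ρ lam = c) = A.integralBoundary σ X lam := by
  have hcone : ∀ ρ : ℂ, ‖ρ‖ = 1 → p ρ → 0 < (ρ * lam).re →
      A.integralCone X ρ lam = A.integralBoundary σ X lam := fun ρ _ him hre =>
    integralCone_eq X hlam hσ (mem_sector_of_re_mul_pos hlam ((hp ρ).1 him) hre)
  obtain ⟨ρ, hnorm, him, hre⟩ : ∃ ρ : ℂ, ‖ρ‖ = 1 ∧ p ρ ∧ 0 < (ρ * lam).re := by
    refine ⟨⟨3 / 5, σ * (4 / 5)⟩, ?_, (hp _).2 ?_, ?_⟩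
    · rcases hσ with rfl | rfl <;> norm_num [Complex.norm_def, Complex.normSq_mk]
    · rcases hσ with rfl | rfl <;> norm_num
    · rw [Complex.re_mul_ofReal]
      positivity
  rw [← hcone ρ hnorm him hre]
  exact (Classical.epsilon_spec (p := fun c => ∀ ρ : ℂ, ‖ρ‖ = 1 → p ρ → 0 < (ρ * lam).re →
    A.integralCone X ρ lam = c) ⟨_, hcone⟩ ρ hnorm him hre).symm

lemma integralPlus_eq (X : A.Vertex) {lam : ℝ} (hlam : 0 < lam) :
    A.integralPlus X lam = A.integralBoundary (-1) X lam :=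
  epsilon_integralCone_eq X hlam (Or.inl rfl) fun ρ => by simp

lemma integralMinus_eq (X : A.Vertex) {lam : ℝ} (hlam : 0 < lam) :
    A.integralMinus X lam = A.integralBoundary 1 X lam :=
  epsilon_integralCone_eq X hlam (Or.inr rfl) fun ρ => by simp

variable {s : Fin N → ℝ} (hs : ∀ j, s j ≠ 0) (hne : (A.chamber s).Nonempty)

include hs hne

/- Both phases count the forms that change sign between the domain and `x`; those of `X` do not
change sign between `Δ_X` and a point of the cone, the others not between the domain and `Δ_X`. -/
lemma exp_weight_mul_phase {X : A.Vertex} (hX : X ∈ A.boundaryVertices (A.chamber s))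
    {x : Fin k → ℝ} (hx : x ∈ A.cone X) (σ : ℝ) :
    Complex.exp (-(σ * Complex.I * Real.pi *
      A.weight (A.separating (A.chamber s) (A.domainAt X)))) * A.phase σ (A.side X) x =
    A.phase σ s x := by
  have hpoly := (A.mem_boundaryVertices_chamber hne X).1 hX
  have hsep : ∀ j, j ∈ A.separating (A.chamber s) (A.domainAt X) ↔ s j * A.side X j < 0 :=
    A.domainAt_eq_chamber X ▸ A.mem_separating_chamber hne (A.chamber_side_nonempty X)
  have hexp : Complex.exp (-(σ * Complex.I * Real.pi *
      A.weight (A.separating (A.chamber s) (A.domainAt X)))) =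
      ∏ j, if s j * A.side X j < 0 then
        Complex.exp (-(σ * Complex.I * Real.pi * A.α j)) else 1 := by
    rw [weight, Complex.ofReal_sum, Finset.mul_sum, ← Finset.sum_neg_distrib, Complex.exp_sum,
      ← Finset.prod_filter]
    exact Finset.prod_congr (Finset.ext fun j => by simp [hsep]) fun _ _ => rfl
  rw [hexp, phase, phase, ← Finset.prod_mul_distrib]
  refine Finset.prod_congr rfl fun j _ => ?_
  by_cases hj : j ∈ X.1
  · have hpos := (A.mem_cone_iff X x).1 hx j hj
    have hiff : s j * A.side X j < 0 ↔ s j * A.f j x < 0 :=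
      mul_neg_iff_mul_neg (mul_self_pos.2 (hs j)) hpos
    simp only [hpos.not_gt, hiff, if_false, mul_one]
  · have hpos := A.mul_side_pos hs hpoly hj
    have hiff : A.side X j * A.f j x < 0 ↔ s j * A.f j x < 0 := by
      simpa using mul_pos_iff_mul_pos (mul_comm (s j) _ ▸ hpos) (-A.f j x)
    simp only [hpos.not_gt, hiff, if_false, one_mul]

lemma chamber_subset_iUnion_cone (hb : BddBelow (A.f0 '' A.chamber s)) :
    A.chamber s ⊆ ⋃ X : A.Vertex, A.cone X := by
  classical
  intro x hx
  have hsum := sum_indicator_cone hs hne hb (A.chamber_subset_compl s hx)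
  rw [if_pos hx] at hsum
  obtain ⟨X, hX, -⟩ := Finset.exists_ne_zero_of_sum_ne_zero (hsum.trans_ne one_ne_zero)
  exact mem_iUnion.2 ⟨X, (Finset.mem_filter.1 hX).2⟩

lemma integrableOn_domainIntegrand_chamber (hb : BddBelow (A.f0 '' A.chamber s)) {lam : ℝ}
    (hlam : 0 < lam) (X : A.Vertex) : IntegrableOn (A.domainIntegrand lam X) (A.chamber s) :=
  (integrableOn_finite_iUnion.2 fun X' => integrableOn_domainIntegrand_cone X' X hlam).mono_set
    (chamber_subset_iUnion_cone hs hne hb)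

lemma indicator_chamber_eq_sum (hb : BddBelow (A.f0 '' A.chamber s)) (F : (Fin k → ℝ) → ℂ) (σ : ℝ)
    {x : Fin k → ℝ} (hx : x ∈ A.compl) :
    (A.chamber s).indicator F x = ∑ X ∈ A.boundaryVertices (A.chamber s),
      ((-1) ^ (A.separating (A.chamber s) (A.domainAt X)).card *
        Complex.exp (-(σ * Complex.I * Real.pi *
          A.weight (A.separating (A.chamber s) (A.domainAt X))))) *
        (A.cone X).indicator (fun x => F x * A.phase σ (A.side X) x) x := by
  classical
  calc (A.chamber s).indicator F x
      = ((if x ∈ A.chamber s then 1 else 0 : ℤ) : ℂ) * (F x * A.phase σ s x) := by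
        by_cases hxs : x ∈ A.chamber s <;> simp [hxs, phase_eq_one]
    _ = ∑ X ∈ A.boundaryVertices (A.chamber s) with x ∈ A.cone X,
          (-1) ^ (A.separating (A.chamber s) (A.domainAt X)).card * (F x * A.phase σ s x) := by
        rw [← sum_indicator_cone hs hne hb hx, Int.cast_sum, Finset.sum_mul]
        push_cast
        rfl
    _ = _ := by
        rw [Finset.sum_filter]
        refine Finset.sum_congr rfl fun X hX => ?_
        split_ifs with hxX
        · rw [indicator_of_mem hxX, ← exp_weight_mul_phase hs hne hX hxX σ]
          ring
        · rw [indicator_of_notMem hxX, mul_zero]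

lemma integralDomain_chamber (hb : BddBelow (A.f0 '' A.chamber s)) {lam : ℝ} (hlam : 0 < lam)
    (σ : ℝ) :
    A.integralDomain (A.chamber s) lam = ∑ X ∈ A.boundaryVertices (A.chamber s),
      ((-1) ^ (A.separating (A.chamber s) (A.domainAt X)).card *
        Complex.exp (-(σ * Complex.I * Real.pi *
          A.weight (A.separating (A.chamber s) (A.domainAt X))))) •
        A.integralBoundary σ X lam := by
  funext X'
  have hcone := fun X : A.Vertex => (A.isOpen_cone X).measurableSet
  rw [integralDomain, Finset.sum_apply, ← integral_indicator (A.isOpen_chamber s).measurableSet,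
    integral_congr_ae (ae_mem_compl.mono fun x hx =>
      indicator_chamber_eq_sum hs hne hb (A.domainIntegrand lam X') σ hx),
    integral_finsetSum _ fun X _ => (((integrableOn_domainIntegrand_mul_phase X X' hlam σ
      _).integrable_indicator (hcone X)).const_mul _)]
  simp only [integral_const_mul, integral_indicator (hcone _), Pi.smul_apply, smul_eq_mul,
    integralBoundary]

end Arrangement

theorem lemma4 {k N : ℕ} (A : Arrangement k N) (Δ : Set (Fin k → ℝ)) (hΔ : Δ ∈ A.domainsPlus)
    (lam : ℝ) (hlam : 0 < lam) :
    -- the integrals over `Δ` converge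
    (∀ X' : A.Vertex, IntegrableOn (A.domainIntegrand lam X') Δ) ∧
    -- the integrals over the rotated cones converge
    (∀ (X X' : A.Vertex) (ρ : ℂ), ‖ρ‖ = 1 → ρ.im ≠ 0 → 0 < (ρ * lam).re →
      IntegrableOn (A.coneIntegrand X ρ lam X') (A.cone X)) ∧
    -- and have the common values `I_X^+` (for `Im ρ < 0`) and `I_X^-` (for `Im ρ > 0`)
    (∀ (X : A.Vertex) (ρ : ℂ), ‖ρ‖ = 1 → ρ.im < 0 → 0 < (ρ * lam).re →
      A.integralCone X ρ lam = A.integralPlus X lam) ∧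
    (∀ (X : A.Vertex) (ρ : ℂ), ‖ρ‖ = 1 → 0 < ρ.im → 0 < (ρ * lam).re →
      A.integralCone X ρ lam = A.integralMinus X lam) ∧
    -- the two expansions
    A.integralDomain Δ lam =
      ∑ X ∈ A.boundaryVertices Δ, A.psi Δ X • A.integralPlus X lam ∧
    A.integralDomain Δ lam =
      ∑ X ∈ A.boundaryVertices Δ, (starRingEnd ℂ) (A.psi Δ X) • A.integralMinus X lam := by
  obtain ⟨⟨x₀, hx₀, rfl⟩, hb⟩ := hΔ
  rw [A.component_eq hx₀] at hb ⊢
  change BddBelow (A.f0 '' A.chamber fun j => A.f j x₀) at hb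
  have hne : (A.chamber fun j => A.f j x₀).Nonempty := ⟨x₀, fun j => mul_self_pos.2 (hx₀ j)⟩
  refine ⟨Arrangement.integrableOn_domainIntegrand_chamber hx₀ hne hb hlam,
    fun X X' ρ _ him hre => ?_, fun X ρ _ him hre => ?_, fun X ρ _ him hre => ?_,
    (Arrangement.integralDomain_chamber hx₀ hne hb hlam (-1)).trans
      (Finset.sum_congr rfl fun X _ => ?_),
    (Arrangement.integralDomain_chamber hx₀ hne hb hlam 1).trans
      (Finset.sum_congr rfl fun X _ => ?_)⟩
  · exact Arrangement.integrableOn_coneIntegrand X X' hlam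
      (mem_sector_of_re_mul_pos hlam (mul_self_pos.2 him) hre).1 him
  · rw [Arrangement.integralPlus_eq X hlam]
    exact Arrangement.integralCone_eq X hlam (Or.inl rfl)
      (mem_sector_of_re_mul_pos hlam (by linarith) hre)
  · rw [Arrangement.integralMinus_eq X hlam]
    exact Arrangement.integralCone_eq X hlam (Or.inr rfl)
      (mem_sector_of_re_mul_pos hlam (by linarith) hre)
  · rw [Arrangement.integralPlus_eq X hlam, A.psi_eq]
    simp [Arrangement.chamber]
  · rw [Arrangement.integralMinus_eq X hlam, A.psi_eq]
    simp [Arrangement.chamber, ← Complex.exp_conj]
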